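/- Proposition. Let $\hat c$ be a constant with $0<\hat c<1/2$. There is a constant $c_1>0$ depending only on $\hat c$ such that the following holds for every dimension $k$, every sample size $N=|\mathcal S_*|$, all unit vectors $\beta_1^*,\beta_2^*\in\mathbb R^k$ and all proportions $p_1,p_2>0$ with $p_1+p_2=1$. Let $y_i=z_i\langle x_i,\beta_1^*\rangle+(1-z_i)\langle x_i,\beta_2^*\rangle$, $i=1,\dots,N$ (no noise), where the pairs $(x_i,z_i)$ are independent, $x_i\sim\mathcal N(0,I_k)$ is independent of the label $z_i\in\{0,1\}$, and $\frac1N\sum_i\mathbb P(z_i=1)=p_1$ (for instance i.i.d. labels with $\mathbb P(z_i=1)=p_1$, or fixed labels of which exactly $p_1N$ equal $1$). Let $M=\frac1N\sum_{i=1}^N y_i^2\,x_i\otimes x_i$. For two pairs $(v_b,\lambda_b)\in\mathbb R^k\times\mathbb R$, $b=1,2$, write $-b$ for the element of $\{1,2\}$ other than $b$, and put $$\Delta_b=\frac{(\lambda_b-\lambda_{-b})^2+p_b^2-p_{-b}^2}{2(\lambda_{-b}-\lambda_b)p_b},\qquad F_b(v,\lambda)=\sqrt{\tfrac{1-\Delta_b}{2}}\;v_b+\mathrm{sign}(b)\sqrt{\tfrac{1+\Delta_b}{2}}\;v_{-b},$$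 where $\mathrm{sign}(1)=1$, $\mathrm{sign}(2)=-1$, and the square root of a negative number is read as $0$. Let $$\kappa=\sqrt{1-4\left(1-\langle\beta_1^*,\beta_2^*\rangle^2\right)p_1p_2},\qquad \sqrt{\tilde\delta}=\hat c\,\min\{p_1,p_2\}^{3/2}\,\|\beta_1^*-\beta_2^*\|_2\,\sqrt{1-\kappa}\;\kappa,$$ and assume $\tilde\delta>0$, i.e. $\beta_1^*\ne\pm\beta_2^*$ and not both $p_1=p_2$ and $\langle\beta_1^*,\beta_2^*\rangle=0$. Suppose $$|\mathcal S_*|=N\ \ge\ c_1\left(\frac1{\tilde\delta}\right)^2k\log^2k .$$ Then: (a) there are orthonormal top two eigenvectors with their eigenvalues, $(v_b^*,\lambda_b^*)_{b=1,2}$, of $\mathbb E[(M-I)/2]$, suitably numbered and signed, with $\beta_b^*=F_b(v^*,\lambda^*)$ for $b=1,2$; (b) for every such choice $(v_b^*,\lambda_b^*)_{b=1,2}$, with probability at least $1-1/k^2$ the following holds. Take orthonormal top two eigenvectors with their eigenvalues, $(v_b,\lambda_b)_{b=1,2}$, of $(M-I)/2$, numbered and signed consistently with $(v_b^*,\lambda_b^*)$,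 that is, $(\lambda_1-\lambda_2)(\lambda_1^*-\lambda_2^*)\ge0$ and $\langle v_b,v_b^*\rangle\ge0$; such a choice exists, and for every such choice the output $\beta_b^{(0)}=F_b(v,\lambda)$, $b=1,2$, of the closed-form initialization satisfies $$err^{(0)}=\max_{b=1,2}\|\beta_b^{(0)}-\beta_b^*\|_2\ \le\ \hat c\,\min\{p_1,p_2\}\,\|\beta_1^*-\beta_2^*\|_2 .$$ -/

import Mathlib

open MeasureTheory ProbabilityTheory

noncomputable section

namespace MixedRegression

/-- `ℝᵏ` with its Euclidean norm and inner product. -/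
abbrev Vec (k : ℕ) : Type := EuclideanSpace ℝ (Fin k)

/-- The noiseless response `⟨x, β₁⟩ z + ⟨x, β₂⟩ (1 - z)`. The two parameter vectors are indexed by
`Fin 2`: `β 0` plays the role of `β₁` and `β 1` that of `β₂`; the label `true` means `β₁`. -/
def response {k : ℕ} (β : Fin 2 → Vec k) (x : Vec k) (z : Bool) : ℝ :=
  if z then inner ℝ x (β 0) else inner ℝ x (β 1)

/-- Covariates `x i` and hidden labels `z i` of `N` samples of the mixture with proportions `p`:
the samples are independent, each covariate is a standard Gaussian vector independent of its label,
and `p 0` is the (expected) fraction of the samples that carry the label `true`. This covers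
i.i.d. labels with `P(z i = true) = p 0` as well as non-random labels of which exactly
`p 0 * N` are `true`. -/
structure IsSample {Ω : Type*} [MeasurableSpace Ω] (μ : Measure Ω) {k N : ℕ} (p : Fin 2 → ℝ)
    (x : Fin N → Ω → Vec k) (z : Fin N → Ω → Bool) : Prop where
  measurable_x : ∀ i, Measurable (x i)
  measurable_z : ∀ i, Measurable (z i)
  law_x : ∀ i, μ.map (x i) = stdGaussian (Vec k)
  indep_samples : iIndepFun (fun i ω => (x i ω, z i ω)) μ
  indep_label : ∀ i, IndepFun (x i) (z i) μ
  fraction : ∑ i, μ.real {ω | z i ω = true} = p 0 * N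

/-- `M = (1/N) ∑ yᵢ² xᵢ ⊗ xᵢ`. -/
def momentMatrix {k N : ℕ} (y : Fin N → ℝ) (x : Fin N → Vec k) : Matrix (Fin k) (Fin k) ℝ :=
  (1 / (N : ℝ)) • ∑ i, (y i) ^ 2 • Matrix.vecMulVec (x i) (x i)

/-- The random matrix `(M - I)/2` formed from the samples. -/
def empMatrix {Ω : Type*} {k N : ℕ} (β : Fin 2 → Vec k) (x : Fin N → Ω → Vec k)
    (z : Fin N → Ω → Bool) (ω : Ω) : Matrix (Fin k) (Fin k) ℝ :=
  (1 / 2 : ℝ) • (momentMatrix (fun i => response β (x i ω) (z i ω)) (fun i => x i ω) - 1)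

/-- The entrywise expectation `E[(M - I)/2]`. -/
def popMatrix {Ω : Type*} [MeasurableSpace Ω] (μ : Measure Ω) {k N : ℕ} (β : Fin 2 → Vec k)
    (x : Fin N → Ω → Vec k) (z : Fin N → Ω → Bool) : Matrix (Fin k) (Fin k) ℝ :=
  Matrix.of fun a b => ∫ ω, empMatrix β x z ω a b ∂μ

/-- `(v b, l b)`, `b = 0, 1`, are orthonormal eigenvectors of the symmetric matrix `A`, with their
eigenvalues, belonging to its two largest eigenvalues counted with multiplicity. Neither the order
of the two pairs nor the signs of the vectors are prescribed. -/
structure IsTopTwoEigenpairs {k : ℕ} (A : Matrix (Fin k) (Fin k) ℝ) (v : Fin 2 → Vec k)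
    (l : Fin 2 → ℝ) : Prop where
  orthonormal : Orthonormal ℝ v
  eigen : ∀ b, Matrix.toEuclideanLin A (v b) = l b • v b
  top : ∀ (w : Vec k) (t : ℝ), w ≠ 0 → Matrix.toEuclideanLin A w = t • w →
    (∀ b, inner ℝ (v b) w = 0) → ∀ b, t ≤ l b

/-- `Δ_b = ((λ_b - λ_{-b})² + p_b² - p_{-b}²) / (2 (λ_{-b} - λ_b) p_b)`; the index `-b`,
i.e. the one different from `b`, is `b.rev`. -/
def Delta (p l : Fin 2 → ℝ) (b : Fin 2) : ℝ :=
  ((l b - l b.rev) ^ 2 + p b ^ 2 - p b.rev ^ 2) / (2 * (l b.rev - l b) * p b)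

/-- `sign(1) = 1`, `sign(2) = -1`. -/
def sgn (b : Fin 2) : ℝ := if b = 0 then 1 else -1

/-- The closed formula `√((1 - Δ_b)/2) v_b + sign(b) √((1 + Δ_b)/2) v_{-b}`. As `Real.sqrt`
vanishes on the negative half-line, a radicand that is negative is replaced by zero. -/
def closedForm {k : ℕ} (p : Fin 2 → ℝ) (v : Fin 2 → Vec k) (l : Fin 2 → ℝ) (b : Fin 2) : Vec k :=
  Real.sqrt ((1 - Delta p l b) / 2) • v b + (sgn b * Real.sqrt ((1 + Delta p l b) / 2)) • v b.rev

/-- `(vs, ls)` are top two eigenpairs of the population matrix, labelled and signed so that the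
closed formula returns the true parameters. -/
def IsReference {k : ℕ} (A : Matrix (Fin k) (Fin k) ℝ) (p : Fin 2 → ℝ) (β : Fin 2 → Vec k)
    (vs : Fin 2 → Vec k) (ls : Fin 2 → ℝ) : Prop :=
  IsTopTwoEigenpairs A vs ls ∧ ∀ b, β b = closedForm p vs ls b

/-- `(v, l)` is labelled and signed like `(vs, ls)`: the eigenvalues are in the same order and
corresponding eigenvectors do not point in opposite directions. -/
def IsAligned {k : ℕ} (v : Fin 2 → Vec k) (l : Fin 2 → ℝ) (vs : Fin 2 → Vec k) (ls : Fin 2 → ℝ) :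
    Prop :=
  0 ≤ (l 0 - l 1) * (ls 0 - ls 1) ∧ ∀ b, 0 ≤ inner ℝ (v b) (vs b)

/-- The error `max_b ‖β_b⁽⁰⁾ - β_b‖`. -/
def err {k : ℕ} (β' β : Fin 2 → Vec k) : ℝ := max ‖β' 0 - β 0‖ ‖β' 1 - β 1‖

/-- `κ = √(1 - 4 (1 - ⟨β₁, β₂⟩²) p₁ p₂)`. -/
def kappa {k : ℕ} (p : Fin 2 → ℝ) (β : Fin 2 → Vec k) : ℝ :=
  Real.sqrt (1 - 4 * (1 - (inner ℝ (β 0) (β 1)) ^ 2) * p 0 * p 1)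

/-- `δ̃`, the square of `ĉ √(min{p₁, p₂})³ ‖β₁ - β₂‖ √(1 - κ) κ`. -/
def deltaTilde {k : ℕ} (c : ℝ) (p : Fin 2 → ℝ) (β : Fin 2 → Vec k) : ℝ :=
  (c * Real.sqrt (min (p 0) (p 1)) ^ 3 * ‖β 0 - β 1‖ * Real.sqrt (1 - kappa p β) * kappa p β) ^ 2

end MixedRegression

end

/-! Since `E[⟨x,β⟩² x ⊗ x] = ‖β‖² I + 2 β ⊗ β` for a standard Gaussian `x`, the population matrix is
`A = p₀ β₀ ⊗ β₀ + p₁ β₁ ⊗ β₁`. Its restriction to the span of the parameters has trace `1` and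
determinant `p₀ p₁ (1 - ⟨β₀,β₁⟩²)`, so the two top eigenvalues are `(1 ± κ)/2`: their gap is `κ`,
and the smaller one lies `(1 - κ)/2` above the rest of the spectrum, which is `0`. In an orthonormal
eigenbasis the off-diagonal entry of `A` vanishes; together with `‖β_b‖ = 1` this determines the
squared coordinates of `β_b` as `(1 ± Δ_b)/2`, and only signs and numbering remain to be chosen
(`IsMixtureForm.delta_eq`, `IsMixtureForm.exists_isReference`).

Stability is deterministic (`err_closedForm_le`). An operator error `ε` moves the eigenvalues by
`O(ε)`, the eigenvectors by `O(ε/κ + ε/(1 - κ))` and `Δ_b` by `O(ε/(κ p_b))`. The square roots in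
the closed formula are only Hölder continuous of exponent `1/2`, so a target accuracy `η = c
min(p₀,p₁) ‖β₀ - β₁‖` requires `ε` of order `η²` times `κ p_b`. This is why `δ̃` is a square and why
`ε = δ̃/48` suffices.

The random part is `‖(empirical) - A‖ ≤ δ̃/48` with probability at least `1 - 1/k²`
(`IsSample.measure_empMatrix_sub_gt_le`). The summands `y² ⟨x,u⟩²` have no exponential moments, so
`y²` is truncated at a level `r`: the truncated summands obey a Chernoff bound for `|θ| r ≤ 1/16`, a
union bound over exponentially many test directions yields the operator norm, and both the
truncation bias and the chance that some `y²` exceeds `r` are exponentially small in `r`. -/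

namespace MixedRegression

/-! ### Top two eigenpairs and Rayleigh quotients of symmetric matrices -/

section Spectral

variable {k : ℕ} {A : Matrix (Fin k) (Fin k) ℝ} {v w : Fin 2 → Vec k} {l : Fin 2 → ℝ}

theorem IsTopTwoEigenpairs.comp_rev (h : IsTopTwoEigenpairs A v l) :
    IsTopTwoEigenpairs A (fun b => v b.rev) (fun b => l b.rev) where
  orthonormal := h.orthonormal.comp _ Fin.rev_injective
  eigen b := h.eigen b.rev
  top u t hu ht ho b := h.top u t hu ht (fun b => by simpa using ho b.rev) b.rev

theorem IsTopTwoEigenpairs.of_eq_or_eq_neg (h : IsTopTwoEigenpairs A v l)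
    (hw : ∀ b, w b = v b ∨ w b = -v b) : IsTopTwoEigenpairs A w l where
  orthonormal := h.orthonormal.orthonormal_of_forall_eq_or_eq_neg hw
  eigen b := by
    rcases hw b with e | e <;> simp [e, h.eigen b]
  top u t hu ht ho b := h.top u t hu ht (fun b => by
    have := ho b
    rcases hw b with e | e <;> simpa [e] using this) b

/-- The first two vectors of an eigenbasis sorted by decreasing eigenvalue work: an eigenvector
orthogonal to both has a nonzero coordinate of some later index, whose eigenvalue is then its own.
-/
theorem exists_isTopTwoEigenpairs (hk : 2 ≤ k) (hA : A.IsHermitian) :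
    ∃ v l, IsTopTwoEigenpairs A v l := by
  have hT := Matrix.isSymmetric_toEuclideanLin_iff.mpr hA
  have hn : Module.finrank ℝ (Vec k) = k := by simp
  set e := hT.eigenvectorBasis hn
  set f : Fin 2 → Fin k := Fin.castLE hk
  have anti := hT.eigenvalues_antitone hn
  refine ⟨fun b => e (f b), fun b => hT.eigenvalues hn (f b), ?_, ?_, ?_⟩
  · exact e.orthonormal.comp f (Fin.castLE_injective hk)
  · intro b
    exact hT.apply_eigenvectorBasis hn (f b)
  · intro u t hu ht ho b
    obtain ⟨i, hi⟩ : ∃ i, e.repr u i ≠ 0 := by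
      by_contra! hcon
      apply hu
      apply e.repr.injective
      ext i
      simpa using hcon i
    have h1 := hT.eigenvectorBasis_apply_self_apply hn u i
    rw [ht] at h1
    have h2 : t = hT.eigenvalues hn i := by
      have : t * e.repr u i = hT.eigenvalues hn i * e.repr u i := by simpa [e] using h1
      exact mul_right_cancel₀ hi this
    rw [h2]
    apply anti
    by_contra! hlt
    have hb : (i : ℕ) < 2 := lt_trans (Fin.lt_def.mp hlt) b.2
    have : f ⟨i, hb⟩ = i := by ext; simp [f]
    apply hi
    rw [OrthonormalBasis.repr_apply_apply, ← this]
    exact ho _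

/-- The field `top` speaks of eigenvectors only. The orthogonal complement of the two vectors is
invariant, so diagonalizing the restriction there turns `top` into a bound for the quadratic form.
-/
theorem IsTopTwoEigenpairs.inner_le_of_orthogonal (hA : A.IsHermitian)
    (h : IsTopTwoEigenpairs A v l) {u : Vec k} (hu : ∀ b, inner ℝ (v b) u = 0) (b : Fin 2) :
    inner ℝ u (Matrix.toEuclideanLin A u) ≤ l b * ‖u‖ ^ 2 := by
  have hT := Matrix.isSymmetric_toEuclideanLin_iff.mpr hA
  set T := Matrix.toEuclideanLin A
  set W : Submodule ℝ (Vec k) := (Submodule.span ℝ (Set.range v))ᗮ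
  have mem_W : ∀ w, w ∈ W ↔ ∀ b, inner ℝ (v b) w = 0 := by
    intro w
    constructor
    · intro hw b
      exact (Submodule.mem_orthogonal _ _).mp hw _ (Submodule.subset_span ⟨b, rfl⟩)
    · intro hw
      rw [Submodule.mem_orthogonal]
      intro x hx
      induction hx using Submodule.span_induction with
      | mem x hx => obtain ⟨b, rfl⟩ := hx; exact hw b
      | zero => simp
      | add x y _ _ hx hy => simp [inner_add_left, hx, hy]
      | smul a x _ hx => simp [inner_smul_left, hx]
  have hW : ∀ w ∈ W, T w ∈ W := by
    intro w hw
    rw [mem_W] at hw ⊢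
    intro b
    rw [← hT, h.eigen b, inner_smul_left, hw b, mul_zero]
  have hS := hT.restrict_invariant hW
  set e := hS.eigenvectorBasis rfl
  set u' : W := ⟨u, (mem_W u).mpr hu⟩
  have hev : ∀ i, hS.eigenvalues rfl i ≤ l b := by
    intro i
    refine h.top (e i : Vec k) _ ?_ ?_ ((mem_W _).mp (e i).2) b
    · intro h0
      have := e.orthonormal.ne_zero i
      exact this (Subtype.ext h0)
    · exact congrArg Subtype.val (hS.apply_eigenvectorBasis rfl i)
  have h1 : inner ℝ u (T u) = ∑ i, hS.eigenvalues rfl i * (inner ℝ (e i) u') ^ 2 := by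
    have h2 : inner ℝ u (T u) = inner ℝ u' (T.restrict hW u') := rfl
    rw [h2, ← e.sum_inner_mul_inner]
    refine Finset.sum_congr rfl fun i _ => ?_
    have h3 := hS.eigenvectorBasis_apply_self_apply rfl u' i
    rw [OrthonormalBasis.repr_apply_apply, OrthonormalBasis.repr_apply_apply] at h3
    rw [real_inner_comm, h3]
    simp only [RCLike.ofReal_real_eq_id, id]
    ring
  have h2 : ‖u‖ ^ 2 = ∑ i, (inner ℝ (e i) u') ^ 2 := by
    have : ‖u‖ = ‖u'‖ := rfl
    rw [this, e.sum_sq_inner_right]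
  rw [h1, h2, Finset.mul_sum]
  exact Finset.sum_le_sum fun i _ => mul_le_mul_of_nonneg_right (hev i) (sq_nonneg _)

/-- Splitting off the component along an eigenvector leaves no mixed term in the quadratic form.
Applied once or twice, this extends the Rayleigh bound from the complement of both eigenvectors to
the complement of one, and then to the whole space. -/
theorem inner_map_self_eq_of_eigenvector {E : Type*} [NormedAddCommGroup E] [InnerProductSpace ℝ E]
    {T : E →ₗ[ℝ] E} (hT : T.IsSymmetric) {a : E} {t : ℝ} (ha : ‖a‖ = 1) (hTa : T a = t • a)
    (u : E) :
    inner ℝ u (T u) = t * inner ℝ a u ^ 2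
        + inner ℝ (u - (inner ℝ a u : ℝ) • a) (T (u - (inner ℝ a u : ℝ) • a)) ∧
      ‖u‖ ^ 2 = inner ℝ a u ^ 2 + ‖u - (inner ℝ a u : ℝ) • a‖ ^ 2 ∧
      inner ℝ a (u - (inner ℝ a u : ℝ) • a) = (0 : ℝ) := by
  have haa : inner ℝ a a = (1 : ℝ) := by rw [real_inner_self_eq_norm_sq, ha]; norm_num
  have h1 : inner ℝ a (T u) = t * inner ℝ a u := by rw [← hT, hTa, real_inner_smul_left]
  refine ⟨?_, ?_, ?_⟩
  · simp only [map_sub, map_smul, hTa, inner_sub_left, inner_sub_right, real_inner_smul_left,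
      real_inner_smul_right, h1, haa, real_inner_comm a u]
    ring
  · rw [← real_inner_self_eq_norm_sq, ← real_inner_self_eq_norm_sq]
    simp only [inner_sub_left, inner_sub_right, real_inner_smul_left,
      real_inner_smul_right, haa, real_inner_comm a u]
    ring
  · rw [inner_sub_right, real_inner_smul_right, haa]; ring

theorem IsTopTwoEigenpairs.inner_le_of_orthogonal_left (hA : A.IsHermitian)
    (h : IsTopTwoEigenpairs A v l) (m : Fin 2) {u : Vec k} (hu : inner ℝ (v m) u = 0) :
    inner ℝ u (Matrix.toEuclideanLin A u) ≤ l m.rev * ‖u‖ ^ 2 := by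
  have hT := Matrix.isSymmetric_toEuclideanLin_iff.mpr hA
  obtain ⟨h1, h2, h3⟩ := inner_map_self_eq_of_eigenvector hT (h.orthonormal.1 m.rev)
    (h.eigen m.rev) u
  set r := u - (inner ℝ (v m.rev) u : ℝ) • v m.rev
  have hne : m ≠ m.rev := by fin_cases m <;> decide
  have hr : ∀ b, inner ℝ (v b) r = 0 := by
    intro b
    have hb : b = m ∨ b = m.rev := by fin_cases m <;> fin_cases b <;> simp
    rcases hb with rfl | rfl
    · simp only [r, inner_sub_right, inner_smul_right, hu, h.orthonormal.2 hne]; simp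
    · exact h3
  have := h.inner_le_of_orthogonal hA hr m.rev
  rw [h1, h2]
  linarith

theorem IsTopTwoEigenpairs.inner_le_max (hA : A.IsHermitian)
    (h : IsTopTwoEigenpairs A v l) (m : Fin 2) (hm : l m.rev ≤ l m) (u : Vec k) :
    inner ℝ u (Matrix.toEuclideanLin A u) ≤ l m * ‖u‖ ^ 2 := by
  have hT := Matrix.isSymmetric_toEuclideanLin_iff.mpr hA
  obtain ⟨h1, h2, h3⟩ := inner_map_self_eq_of_eigenvector hT (h.orthonormal.1 m) (h.eigen m) u
  have := h.inner_le_of_orthogonal_left hA m h3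
  rw [h1, h2]
  have h4 := mul_le_mul_of_nonneg_right hm (sq_nonneg ‖u - (inner ℝ (v m) u : ℝ) • v m‖)
  linarith

end Spectral

/-! ### Population matrix: eigenvalues, closed formula, choice of signs -/

section Reference

variable {k : ℕ} {A : Matrix (Fin k) (Fin k) ℝ} {p : Fin 2 → ℝ} {β : Fin 2 → Vec k}
  {v vs : Fin 2 → Vec k} {l ls : Fin 2 → ℝ}

/-- `A` acts as `∑ p_b β_b ⊗ β_b`. -/
def IsMixtureForm (A : Matrix (Fin k) (Fin k) ℝ) (p : Fin 2 → ℝ) (β : Fin 2 → Vec k) : Prop :=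
  ∀ u : Vec k, Matrix.toEuclideanLin A u
    = (p 0 * inner ℝ (β 0) u) • β 0 + (p 1 * inner ℝ (β 1) u) • β 1

/-- The parameters lie in the span of `v`. -/
def InSpan (v β : Fin 2 → Vec k) : Prop :=
  ∀ j, β j = (inner ℝ (v 0) (β j) : ℝ) • v 0 + (inner ℝ (v 1) (β j) : ℝ) • v 1

theorem Orthonormal.inner_pair (hv : Orthonormal ℝ v) :
    inner ℝ (v 0) (v 0) = (1 : ℝ) ∧ inner ℝ (v 1) (v 1) = (1 : ℝ) ∧
      inner ℝ (v 0) (v 1) = (0 : ℝ) ∧ inner ℝ (v 1) (v 0) = (0 : ℝ) := by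
  refine ⟨?_, ?_, hv.2 (by decide), hv.2 (by decide)⟩ <;>
    rw [real_inner_self_eq_norm_sq, hv.1] <;> norm_num

theorem InSpan.inner_eq (hs : InSpan v β) (i j : Fin 2) :
    (inner ℝ (β i) (β j) : ℝ) = inner ℝ (v 0) (β i) * inner ℝ (v 0) (β j)
      + inner ℝ (v 1) (β i) * inner ℝ (v 1) (β j) := by
  conv_lhs => rw [hs i]
  simp only [inner_add_left, real_inner_smul_left]

theorem InSpan.sq_add_sq (hs : InSpan v β) (hβ : ∀ b, ‖β b‖ = 1)
    (j : Fin 2) : (inner ℝ (v 0) (β j) : ℝ) ^ 2 + inner ℝ (v 1) (β j) ^ 2 = 1 := by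
  have := hs.inner_eq j j
  rw [real_inner_self_eq_norm_sq, hβ] at this
  linarith

theorem IsMixtureForm.eigenvalue_eq (hA : IsMixtureForm A p β) (hv : Orthonormal ℝ v)
    (he : ∀ b, Matrix.toEuclideanLin A (v b) = l b • v b) (b : Fin 2) :
    l b = p 0 * inner ℝ (v b) (β 0) ^ 2 + p 1 * inner ℝ (v b) (β 1) ^ 2 := by
  have h1 : inner ℝ (v b) (Matrix.toEuclideanLin A (v b)) = l b := by
    rw [he, real_inner_smul_right, real_inner_self_eq_norm_sq, hv.1]; ring
  rw [← h1, hA, inner_add_right, real_inner_smul_right, real_inner_smul_right,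
    real_inner_comm (v b) (β 0), real_inner_comm (v b) (β 1)]
  ring

/-- The off-diagonal entry of the operator in its own eigenbasis. This single relation drives both
the formula for `Delta` and the sign pattern of the coordinates. -/
theorem IsMixtureForm.cross_eq_zero (hA : IsMixtureForm A p β) (hv : Orthonormal ℝ v)
    (he : ∀ b, Matrix.toEuclideanLin A (v b) = l b • v b) :
    p 0 * (inner ℝ (v 0) (β 0) * inner ℝ (v 1) (β 0))
      + p 1 * (inner ℝ (v 0) (β 1) * inner ℝ (v 1) (β 1)) = 0 := by
  have h1 : inner ℝ (v 0) (Matrix.toEuclideanLin A (v 1)) = (0 : ℝ) := by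
    rw [he, real_inner_smul_right, hv.2 (by decide), mul_zero]
  rw [← h1, hA, inner_add_right, real_inner_smul_right, real_inner_smul_right,
    real_inner_comm (v 1) (β 0), real_inner_comm (v 1) (β 1)]
  ring

theorem kappa_sq (hp : ∀ b, 0 < p b) (hp1 : p 0 + p 1 = 1) :
    kappa p β ^ 2 = 1 - 4 * (1 - (inner ℝ (β 0) (β 1)) ^ 2) * p 0 * p 1 := by
  rw [kappa, Real.sq_sqrt]
  have h0 := hp 0
  have h1 := hp 1
  have h2 : p 1 = 1 - p 0 := by linarith
  have : 0 ≤ (p 0 - p 1) ^ 2 + 4 * (inner ℝ (β 0) (β 1)) ^ 2 * (p 0 * p 1) := by positivity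
  rw [h2] at this ⊢
  linarith

/-- From `κ² = (p₀ - p₁)² + 4 ⟨β₀,β₁⟩² p₀ p₁`. It later cancels one factor `1/κ` in the stability of
`Delta`. -/
theorem sq_sub_le_kappa_sq (hp : ∀ b, 0 < p b) (hp1 : p 0 + p 1 = 1) :
    (p 0 - p 1) ^ 2 ≤ kappa p β ^ 2 := by
  rw [kappa_sq hp hp1]
  have h2 : p 1 = 1 - p 0 := by linarith
  have : 0 ≤ (inner ℝ (β 0) (β 1)) ^ 2 * (p 0 * p 1) :=
    mul_nonneg (sq_nonneg _) (mul_pos (hp 0) (hp 1)).le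
  rw [h2] at this ⊢
  linarith

theorem kappa_nonneg : 0 ≤ kappa p β := Real.sqrt_nonneg _

theorem IsMixtureForm.eigenvalue_add (hA : IsMixtureForm A p β) (hv : Orthonormal ℝ v)
    (he : ∀ b, Matrix.toEuclideanLin A (v b) = l b • v b) (hs : InSpan v β)
    (hβ : ∀ b, ‖β b‖ = 1) (hp1 : p 0 + p 1 = 1) : l 0 + l 1 = 1 := by
  have h0 := hA.eigenvalue_eq hv he 0
  have h1 := hA.eigenvalue_eq hv he 1
  have h2 := hs.sq_add_sq hβ 0
  have h3 := hs.sq_add_sq hβ 1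
  linear_combination h0 + h1 + p 0 * h2 + p 1 * h3 + hp1

/-- The discriminant of the restriction to the plane: the trace is `1`, and the determinant is `p₀
p₁` times the squared determinant of the coordinates, which equals `1 - ⟨β₀,β₁⟩²` by Lagrange's
identity. -/
theorem IsMixtureForm.eigenvalue_sub_sq (hA : IsMixtureForm A p β) (hv : Orthonormal ℝ v)
    (he : ∀ b, Matrix.toEuclideanLin A (v b) = l b • v b) (hs : InSpan v β)
    (hβ : ∀ b, ‖β b‖ = 1) (hp : ∀ b, 0 < p b) (hp1 : p 0 + p 1 = 1) :
    (l 0 - l 1) ^ 2 = kappa p β ^ 2 := by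
  have h0 := hA.eigenvalue_eq hv he 0
  have h1 := hA.eigenvalue_eq hv he 1
  have hx := hA.cross_eq_zero hv he
  have h2 := hs.sq_add_sq hβ 0
  have h3 := hs.sq_add_sq hβ 1
  have hadd := hA.eigenvalue_add hv he hs hβ hp1
  rw [kappa_sq hp hp1, hs.inner_eq 0 1]
  set x0 : ℝ := inner ℝ (v 0) (β 0)
  set x1 : ℝ := inner ℝ (v 1) (β 0)
  set y0 : ℝ := inner ℝ (v 0) (β 1)
  set y1 : ℝ := inner ℝ (v 1) (β 1)
  have hl : l 0 * l 1 = p 0 * p 1 * (x0 * y1 - x1 * y0) ^ 2 := by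
    rw [h0, h1]
    linear_combination (p 0 * (x0 * x1) + p 1 * (y0 * y1)) * hx
  have hdet : (x0 * y1 - x1 * y0) ^ 2 = 1 - (x0 * y0 + x1 * y1) ^ 2 := by
    linear_combination (y0 ^ 2 + y1 ^ 2) * h2 + h3
  rw [hdet] at hl
  linear_combination (l 0 + l 1 + 1) * hadd - 4 * hl

/-- The radicands in the closed formula are the squared coordinates of the parameters. -/
theorem IsMixtureForm.delta_eq (hA : IsMixtureForm A p β) (hv : Orthonormal ℝ v)
    (he : ∀ b, Matrix.toEuclideanLin A (v b) = l b • v b) (hs : InSpan v β)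
    (hβ : ∀ b, ‖β b‖ = 1) (hp : ∀ b, 0 < p b) (hl : l 0 ≠ l 1) :
    Delta p l 0 = inner ℝ (v 1) (β 0) ^ 2 - inner ℝ (v 0) (β 0) ^ 2 ∧
      Delta p l 1 = inner ℝ (v 0) (β 1) ^ 2 - inner ℝ (v 1) (β 1) ^ 2 := by
  have h0 := hA.eigenvalue_eq hv he 0
  have h1 := hA.eigenvalue_eq hv he 1
  have hx := hA.cross_eq_zero hv he
  have h2 := hs.sq_add_sq hβ 0
  have h3 := hs.sq_add_sq hβ 1
  have hp0 := (hp 0).ne'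
  have hp1 := (hp 1).ne'
  have hd0 : l 1 - l 0 ≠ 0 := sub_ne_zero.mpr hl.symm
  have hd1 : l 0 - l 1 ≠ 0 := sub_ne_zero.mpr hl
  set x0 : ℝ := inner ℝ (v 0) (β 0)
  set x1 : ℝ := inner ℝ (v 1) (β 0)
  set y0 : ℝ := inner ℝ (v 0) (β 1)
  set y1 : ℝ := inner ℝ (v 1) (β 1)
  -- This is the relation `cross_eq_zero` squared. With `X = x0² - x1²`, `Y = y0² - y1²` and `d = p₀
  -- X + p₁ Y` it gives `p₀² - p₁² = d (p₀ X - p₁ Y)`, so the numerator of `Delta p l 0` is `2 d p₀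
  -- X` and the quotient is `-X`.
  have key : p 0 ^ 2 * (1 - (x0 ^ 2 - x1 ^ 2) ^ 2) = p 1 ^ 2 * (1 - (y0 ^ 2 - y1 ^ 2) ^ 2) := by
    have e1 : 1 - (x0 ^ 2 - x1 ^ 2) ^ 2 = 4 * (x0 * x1) ^ 2 := by
      linear_combination (-(x0 ^ 2 + x1 ^ 2) - 1) * h2
    have e2 : 1 - (y0 ^ 2 - y1 ^ 2) ^ 2 = 4 * (y0 * y1) ^ 2 := by
      linear_combination (-(y0 ^ 2 + y1 ^ 2) - 1) * h3
    rw [e1, e2]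
    linear_combination 4 * (p 0 * (x0 * x1) - p 1 * (y0 * y1)) * hx
  have hd : l 0 - l 1 = p 0 * (x0 ^ 2 - x1 ^ 2) + p 1 * (y0 ^ 2 - y1 ^ 2) := by
    rw [h0, h1]; ring
  constructor
  · simp only [Delta]
    rw [show (0 : Fin 2).rev = 1 from rfl, div_eq_iff (by positivity)]
    linear_combination (l 0 - l 1 + p 0 * (x0 ^ 2 - x1 ^ 2) + p 1 * (y0 ^ 2 - y1 ^ 2)
      - 2 * p 0 * (x0 ^ 2 - x1 ^ 2)) * hd + key
  · simp only [Delta]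
    rw [show (1 : Fin 2).rev = 0 from rfl, div_eq_iff (by positivity)]
    linear_combination (l 0 - l 1 + p 0 * (x0 ^ 2 - x1 ^ 2) + p 1 * (y0 ^ 2 - y1 ^ 2)
      - 2 * p 1 * (y0 ^ 2 - y1 ^ 2)) * hd - key

theorem IsMixtureForm.eq_closedForm (hA : IsMixtureForm A p β) (hv : Orthonormal ℝ v)
    (he : ∀ b, Matrix.toEuclideanLin A (v b) = l b • v b) (hs : InSpan v β)
    (hβ : ∀ b, ‖β b‖ = 1) (hp : ∀ b, 0 < p b) (hl : l 0 ≠ l 1)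
    (h00 : 0 ≤ inner ℝ (v 0) (β 0)) (h01 : 0 ≤ inner ℝ (v 1) (β 0))
    (h10 : inner ℝ (v 0) (β 1) ≤ 0) (h11 : 0 ≤ inner ℝ (v 1) (β 1)) (b : Fin 2) :
    β b = closedForm p v l b := by
  obtain ⟨d0, d1⟩ := hA.delta_eq hv he hs hβ hp hl
  have h2 := hs.sq_add_sq hβ 0
  have h3 := hs.sq_add_sq hβ 1
  fin_cases b
  · simp only [closedForm, sgn, Fin.zero_eta, Fin.rev_zero, d0]
    rw [show (1 - (inner ℝ (v 1) (β 0) ^ 2 - inner ℝ (v 0) (β 0) ^ 2)) / 2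
        = (inner ℝ (v 0) (β 0) : ℝ) ^ 2 by linarith,
      show (1 + (inner ℝ (v 1) (β 0) ^ 2 - inner ℝ (v 0) (β 0) ^ 2)) / 2
        = (inner ℝ (v 1) (β 0) : ℝ) ^ 2 by linarith, Real.sqrt_sq h00, Real.sqrt_sq h01]
    simpa using hs 0
  · simp only [closedForm, sgn, Fin.mk_one, d1, show (1 : Fin 2).rev = 0 from rfl]
    rw [show (1 - (inner ℝ (v 0) (β 1) ^ 2 - inner ℝ (v 1) (β 1) ^ 2)) / 2
        = (inner ℝ (v 1) (β 1) : ℝ) ^ 2 by linarith,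
      show (1 + (inner ℝ (v 0) (β 1) ^ 2 - inner ℝ (v 1) (β 1) ^ 2)) / 2
        = (-inner ℝ (v 0) (β 1) : ℝ) ^ 2 by linarith, Real.sqrt_sq h11,
      Real.sqrt_sq (by linarith)]
    simpa using (hs 1).trans (add_comm _ _)

theorem IsMixtureForm.isSymmetric (hA : IsMixtureForm A p β) :
    (Matrix.toEuclideanLin A).IsSymmetric := by
  intro x y
  rw [hA, hA]
  simp only [inner_add_left, inner_add_right, real_inner_smul_left, real_inner_smul_right,
    real_inner_comm x]
  ring

/-- The plane spanned by the parameters is invariant, so the spectral theorem applies inside it. Off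
the plane the operator is zero, while its eigenvalues in the plane are nonnegative, hence they are
the top ones. -/
theorem IsMixtureForm.exists_eigenpairs (hA : IsMixtureForm A p β) (hp : ∀ b, 0 < p b)
    (hβ : LinearIndependent ℝ β) :
    ∃ v l, IsTopTwoEigenpairs A v l ∧ InSpan v β := by
  have hT := hA.isSymmetric
  set U : Submodule ℝ (Vec k) := Submodule.span ℝ (Set.range β)
  have hmem : ∀ b, β b ∈ U := fun b => Submodule.subset_span ⟨b, rfl⟩
  have hU : ∀ w ∈ U, Matrix.toEuclideanLin A w ∈ U := by
    intro w _
    rw [hA]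
    exact U.add_mem (U.smul_mem _ (hmem 0)) (U.smul_mem _ (hmem 1))
  have hn : Module.finrank ℝ U = 2 := by simpa using finrank_span_eq_card hβ
  have hS := hT.restrict_invariant hU
  set e := hS.eigenvectorBasis hn
  have hs : InSpan (fun b => (e b : Vec k)) β := by
    intro j
    have := congrArg Subtype.val (e.sum_repr' ⟨β j, hmem j⟩)
    rw [Fin.sum_univ_two] at this
    exact this.symm
  have ho : Orthonormal ℝ (fun b => (e b : Vec k)) :=
    e.orthonormal.comp_linearIsometry U.subtypeₗᵢ
  have he : ∀ b, Matrix.toEuclideanLin A (e b : Vec k) = hS.eigenvalues hn b • (e b : Vec k) :=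
    fun b => congrArg Subtype.val (hS.apply_eigenvectorBasis hn b)
  refine ⟨fun b => (e b : Vec k), hS.eigenvalues hn, ⟨ho, he, ?_⟩, hs⟩
  intro w t hw ht hwo b
  have hz : ∀ j, inner ℝ (β j) w = (0 : ℝ) := by
    intro j
    rw [hs j, inner_add_left, real_inner_smul_left, real_inner_smul_left, hwo 0, hwo 1]
    simp
  have h0 : t • w = 0 := by rw [← ht, hA, hz, hz]; simp
  have ht0 : t = 0 := (smul_eq_zero.mp h0).resolve_right hw
  rw [ht0, hA.eigenvalue_eq ho he b]
  have := hp 0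
  have := hp 1
  positivity

theorem InSpan.of_eq_or_eq_neg {w : Fin 2 → Vec k} (hs : InSpan v β)
    (hw : ∀ b, w b = v b ∨ w b = -v b) : InSpan w β := by
  intro j
  have := hs j
  rcases hw 0 with e | e <;> rcases hw 1 with e' | e' <;> simpa [e, e'] using this

theorem InSpan.comp_rev (hs : InSpan v β) : InSpan (fun b => v b.rev) β := by
  intro j
  have := hs j
  rw [add_comm] at this
  exact this

theorem exists_sign (a : ℝ) : ∃ s : ℝ, (s = 1 ∨ s = -1) ∧ 0 ≤ s * a := by
  rcases le_total 0 a with h | h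
  · exact ⟨1, Or.inl rfl, by linarith⟩
  · exact ⟨-1, Or.inr rfl, by linarith⟩

/-- The closed formula needs `β 0` to have two nonnegative coordinates, and `β 1` a nonpositive and
a nonnegative one, in this order. Signs of the eigenvectors settle `β 0`; `cross_eq_zero` then gives
the coordinates of `β 1` opposite signs, and exchanging the eigenvectors puts them in order. -/
theorem IsMixtureForm.exists_isReference (hA : IsMixtureForm A p β) (hp : ∀ b, 0 < p b)
    (hp1 : p 0 + p 1 = 1) (hβ : ∀ b, ‖β b‖ = 1) (hi : LinearIndependent ℝ β)
    (hκ : 0 < kappa p β) : ∃ vs ls, IsReference A p β vs ls := by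
  suffices h : ∃ v l, IsTopTwoEigenpairs A v l ∧ InSpan v β ∧ 0 ≤ inner ℝ (v 0) (β 0) ∧
      0 ≤ inner ℝ (v 1) (β 0) ∧ inner ℝ (v 0) (β 1) ≤ 0 ∧ 0 ≤ inner ℝ (v 1) (β 1) by
    obtain ⟨v, l, h, hs, h00, h01, h10, h11⟩ := h
    refine ⟨v, l, h, hA.eq_closedForm h.orthonormal h.eigen hs hβ hp ?_ h00 h01 h10 h11⟩
    intro hl
    have := hA.eigenvalue_sub_sq h.orthonormal h.eigen hs hβ hp hp1
    rw [hl, sub_self] at this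
    nlinarith
  -- After a choice of signs the coordinates of `β 0` are nonnegative.
  obtain ⟨v, l, h, hs, h00, h01⟩ : ∃ v l, IsTopTwoEigenpairs A v l ∧ InSpan v β ∧
      0 ≤ inner ℝ (v 0) (β 0) ∧ 0 ≤ inner ℝ (v 1) (β 0) := by
    obtain ⟨v, l, h, hs⟩ := hA.exists_eigenpairs hp hi
    choose s hs1 hs0 using fun b => exists_sign (inner ℝ (v b) (β 0))
    have hw : ∀ b, s b • v b = v b ∨ s b • v b = -v b := by
      intro b
      rcases hs1 b with e | e <;> simp [e]
    refine ⟨fun b => s b • v b, l, h.of_eq_or_eq_neg hw, hs.of_eq_or_eq_neg hw, ?_, ?_⟩ <;>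
    · rw [real_inner_smul_left]; exact hs0 _
  have hdet : inner ℝ (v 0) (β 0) * inner ℝ (v 1) (β 1)
      - inner ℝ (v 1) (β 0) * inner ℝ (v 0) (β 1) ≠ (0 : ℝ) := by
    intro h0
    have e0 := hs 0
    have e1 := hs 1
    set x0 : ℝ := inner ℝ (v 0) (β 0)
    set x1 : ℝ := inner ℝ (v 1) (β 0)
    set y0 : ℝ := inner ℝ (v 0) (β 1)
    set y1 : ℝ := inner ℝ (v 1) (β 1)
    rw [linearIndependent_fin2] at hi
    refine hi.2 (x0 * y0 + x1 * y1) ?_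
    have h2 := hs.sq_add_sq hβ 0
    have h3 := hs.sq_add_sq hβ 1
    rw [e0, e1, smul_add, smul_smul, smul_smul]
    congr 2
    · linear_combination x0 * h3 - y1 * h0
    · linear_combination x1 * h3 + y0 * h0
  have hx := hA.cross_eq_zero h.orthonormal h.eigen
  have hp0 := hp 0
  have hp1 := hp 1
  -- The degenerate case, in which each parameter is parallel to one eigenvector: the sign of the
  -- second eigenvector is not fixed by `β 0` and can be adapted to `β 1`. If one coordinate of `β
  -- 0` vanishes, `cross_eq_zero` and `hdet` lead here.
  have flip : ∀ (v : Fin 2 → Vec k) (l : Fin 2 → ℝ), IsTopTwoEigenpairs A v l → InSpan v β →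
      0 ≤ inner ℝ (v 0) (β 0) → inner ℝ (v 1) (β 0) = (0 : ℝ) → inner ℝ (v 0) (β 1) = (0 : ℝ) →
      ∃ v l, IsTopTwoEigenpairs A v l ∧ InSpan v β ∧ 0 ≤ inner ℝ (v 0) (β 0) ∧
      0 ≤ inner ℝ (v 1) (β 0) ∧ inner ℝ (v 0) (β 1) ≤ 0 ∧ 0 ≤ inner ℝ (v 1) (β 1) := by
    intro v l h hs h0 h1 h2
    obtain ⟨s, hs1, hs0⟩ := exists_sign (inner ℝ (v 1) (β 1))
    have hw : ∀ b, (![v 0, s • v 1] b = v b ∨ ![v 0, s • v 1] b = -v b) := by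
      intro b
      fin_cases b
      · simp
      · rcases hs1 with e | e <;> simp [e]
    refine ⟨_, l, h.of_eq_or_eq_neg hw, hs.of_eq_or_eq_neg hw, ?_, ?_, ?_, ?_⟩
    · simpa using h0
    · simp [real_inner_smul_left, h1]
    · simp [h2]
    · simpa [real_inner_smul_left] using hs0
  rcases h00.eq_or_lt with z0 | z0
  · have hy : (inner ℝ (v 1) (β 1) : ℝ) = 0 := by
      rw [← z0] at hx hdet
      have h1 : (inner ℝ (v 0) (β 1) : ℝ) ≠ 0 := fun h => hdet (by rw [h]; ring)
      have h2 : p 1 * (inner ℝ (v 0) (β 1) * inner ℝ (v 1) (β 1)) = 0 := by linarith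
      simpa [hp1.ne', h1] using h2
    exact flip _ _ h.comp_rev hs.comp_rev h01 z0.symm hy
  rcases h01.eq_or_lt with z1 | z1
  · have hy : (inner ℝ (v 0) (β 1) : ℝ) = 0 := by
      rw [← z1] at hx hdet
      have h1 : (inner ℝ (v 1) (β 1) : ℝ) ≠ 0 := fun h => hdet (by rw [h]; ring)
      have h2 : p 1 * (inner ℝ (v 0) (β 1) * inner ℝ (v 1) (β 1)) = 0 := by linarith
      simpa [hp1.ne', h1] using h2
    exact flip _ _ h hs h00 z1.symm hy
  have hneg : inner ℝ (v 0) (β 1) * inner ℝ (v 1) (β 1) < (0 : ℝ) := by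
    have := mul_pos hp0 (mul_pos z0 z1)
    by_contra! hcon
    have := mul_nonneg hp1.le hcon
    linarith
  rcases mul_neg_iff.mp hneg with ⟨ha, hb⟩ | ⟨ha, hb⟩
  · exact ⟨_, _, h.comp_rev, hs.comp_rev, h01, h00, hb.le, ha.le⟩
  · exact ⟨v, l, h, hs, h00, h01, ha.le, hb.le⟩

end Reference

/-! ### Approximate eigenvectors of a rank two operator -/

section PlanePerturbation

variable {E : Type*} [NormedAddCommGroup E] [InnerProductSpace ℝ E]

theorem norm_sq_add_add {e f r : E} (he : ‖e‖ = 1) (hf : ‖f‖ = 1)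
    (hef : inner ℝ e f = (0 : ℝ)) (her : inner ℝ e r = (0 : ℝ)) (hfr : inner ℝ f r = (0 : ℝ))
    (x y z : ℝ) : ‖x • e + y • f + z • r‖ ^ 2 = x ^ 2 + y ^ 2 + z ^ 2 * ‖r‖ ^ 2 := by
  have hee : inner ℝ e e = (1 : ℝ) := by rw [real_inner_self_eq_norm_sq, he]; norm_num
  have hff : inner ℝ f f = (1 : ℝ) := by rw [real_inner_self_eq_norm_sq, hf]; norm_num
  have hfe : inner ℝ f e = (0 : ℝ) := by rw [real_inner_comm, hef]
  have hre : inner ℝ r e = (0 : ℝ) := by rw [real_inner_comm, her]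
  have hrf : inner ℝ r f = (0 : ℝ) := by rw [real_inner_comm, hfr]
  rw [← real_inner_self_eq_norm_sq, ← real_inner_self_eq_norm_sq]
  simp only [inner_add_left, inner_add_right, real_inner_smul_left, real_inner_smul_right,
    hee, hff, hef, hfe, her, hre, hfr, hrf]
  ring

/-- The components of an eigenvector of an operator that is within `ε` of `a e ⊗ e + b f ⊗ f`. -/
theorem exists_residual_of_eigenvector {e f u : E} (he : ‖e‖ = 1) (hf : ‖f‖ = 1)
    (hef : inner ℝ e f = (0 : ℝ)) (hu : ‖u‖ = 1) {a b t ε : ℝ}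
    (h : ‖t • u - ((a * inner ℝ e u) • e + (b * inner ℝ f u) • f)‖ ≤ ε) :
    ∃ ρ : ℝ, 0 ≤ ρ ∧ inner ℝ e u ^ 2 + inner ℝ f u ^ 2 + ρ = 1 ∧
      (t - a) ^ 2 * inner ℝ e u ^ 2 + (t - b) ^ 2 * inner ℝ f u ^ 2 + t ^ 2 * ρ ≤ ε ^ 2 := by
  have hee : inner ℝ e e = (1 : ℝ) := by rw [real_inner_self_eq_norm_sq, he]; norm_num
  have hff : inner ℝ f f = (1 : ℝ) := by rw [real_inner_self_eq_norm_sq, hf]; norm_num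
  have hfe : inner ℝ f e = (0 : ℝ) := by rw [real_inner_comm, hef]
  set ξ : ℝ := inner ℝ e u
  set ζ : ℝ := inner ℝ f u
  set r := u - ξ • e - ζ • f with hr
  have her : inner ℝ e r = (0 : ℝ) := by
    simp only [hr, inner_sub_right, real_inner_smul_right, hee, hef]
    simp [ξ]
  have hfr : inner ℝ f r = (0 : ℝ) := by
    simp only [hr, inner_sub_right, real_inner_smul_right, hff, hfe]
    simp [ζ]
  refine ⟨‖r‖ ^ 2, sq_nonneg _, ?_, ?_⟩
  · have := norm_sq_add_add he hf hef her hfr ξ ζ 1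
    rw [show ξ • e + ζ • f + (1 : ℝ) • r = u by rw [hr]; module, hu] at this
    linarith
  · have := norm_sq_add_add he hf hef her hfr ((t - a) * ξ) ((t - b) * ζ) t
    rw [show ((t - a) * ξ) • e + ((t - b) * ζ) • f + t • r
      = t • u - ((a * ξ) • e + (b * ζ) • f) by rw [hr]; module] at this
    have h2 := pow_le_pow_left₀ (norm_nonneg _) h 2
    rw [this] at h2
    linarith

theorem norm_sub_sq_le_of_inner_nonneg {e u : E} (he : ‖e‖ = 1) (hu : ‖u‖ = 1)
    (h : 0 ≤ inner ℝ e u) : ‖u - e‖ ^ 2 ≤ 2 * (1 - inner ℝ e u ^ 2) := by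
  have h1 : inner ℝ e u ≤ (1 : ℝ) := by
    have := real_inner_le_norm e u
    rwa [he, hu, one_mul] at this
  rw [norm_sub_sq_real, he, hu, real_inner_comm]
  nlinarith

end PlanePerturbation

/-! ### Perturbation of eigenpairs and of the closed formula -/

section Perturbation

variable {k : ℕ} {A B : Matrix (Fin k) (Fin k) ℝ} {p : Fin 2 → ℝ} {β : Fin 2 → Vec k}
  {v vs : Fin 2 → Vec k} {l ls : Fin 2 → ℝ} {ε : ℝ}

set_option maxHeartbeats 1000000 in
/-- Eigenvalues and eigenvectors of a perturbation of the rank two operator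
`∑ ls_b vs_b ⊗ vs_b` whose larger eigenvalue has index `m`. -/
theorem IsTopTwoEigenpairs.perturbation (hB : B.IsHermitian) (h : IsTopTwoEigenpairs B v l)
    (hvs : Orthonormal ℝ vs) (m : Fin 2)
    (hE : ∀ u, ‖Matrix.toEuclideanLin B u - ((ls m * inner ℝ (vs m) u) • vs m
      + (ls m.rev * inner ℝ (vs m.rev) u) • vs m.rev)‖ ≤ ε * ‖u‖)
    (hε : 0 ≤ ε) (hgap : 8 * ε ≤ ls m - ls m.rev) (hpos : 8 * ε ≤ ls m.rev)
    (hgap0 : 0 < ls m - ls m.rev) (hpos0 : 0 < ls m.rev)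
    (hm : l m.rev ≤ l m) (hal : ∀ b, 0 ≤ inner ℝ (v b) (vs b)) :
    |l m - ls m| ≤ 2 * ε ∧ |l m.rev - ls m.rev| ≤ 2 * ε ∧
      ‖v m - vs m‖ ≤ 3 * (ε / (ls m - ls m.rev)) ∧
      ‖v m.rev - vs m.rev‖ ≤ 5 * (ε / (ls m - ls m.rev) + ε / ls m.rev) := by
  set m' := m.rev with hm'
  have hne : m ≠ m' := by rw [hm']; fin_cases m <;> decide
  set a := ls m
  set b := ls m'
  set κ := a - b with hκ
  set e := vs m
  set f := vs m'
  have he : ‖e‖ = 1 := hvs.1 m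
  have hf : ‖f‖ = 1 := hvs.1 m'
  have hef : inner ℝ e f = (0 : ℝ) := hvs.2 hne
  have hfe : inner ℝ f e = (0 : ℝ) := hvs.2 hne.symm
  have hee : inner ℝ e e = (1 : ℝ) := by rw [real_inner_self_eq_norm_sq, he]; norm_num
  have hff : inner ℝ f f = (1 : ℝ) := by rw [real_inner_self_eq_norm_sq, hf]; norm_num
  have hquad : ∀ u : Vec k, a * inner ℝ e u ^ 2 + b * inner ℝ f u ^ 2 - ε * ‖u‖ ^ 2
      ≤ inner ℝ u (Matrix.toEuclideanLin B u) := by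
    intro u
    have h1 := hE u
    have h2 := (abs_le.mp (abs_real_inner_le_norm u (Matrix.toEuclideanLin B u -
      ((a * inner ℝ e u) • e + (b * inner ℝ f u) • f)))).1
    rw [inner_sub_right, inner_add_right, real_inner_smul_right, real_inner_smul_right,
      real_inner_comm e u, real_inner_comm f u] at h2
    have h3 := mul_le_mul_of_nonneg_left h1 (norm_nonneg u)
    nlinarith
  have hres : ∀ j, ‖l j • v j - ((a * inner ℝ e (v j)) • e + (b * inner ℝ f (v j)) • f)‖ ≤ ε := by
    intro j
    have := hE (v j)
    rwa [h.eigen j, h.orthonormal.1 j, mul_one] at this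
  -- the leading eigenpair
  have hlm : a - ε ≤ l m := by
    have h1 := hquad e
    have h2 := h.inner_le_max hB m hm e
    rw [hee, hfe, he] at h1
    rw [he] at h2
    linarith
  obtain ⟨ρ, hρ, hsum, hbd⟩ := exists_residual_of_eigenvector he hf hef (h.orthonormal.1 m) (hres m)
  have hξ0 : 0 ≤ inner ℝ e (v m) := by rw [real_inner_comm]; exact hal m
  have hnorm := norm_sub_sq_le_of_inner_nonneg he (h.orthonormal.1 m) hξ0
  set ξ : ℝ := inner ℝ e (v m) with hξ
  set ζ : ℝ := inner ℝ f (v m) with hζ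
  -- Both `l m - b` and `l m` are at least `κ / 2`, so the residual bound controls all of the mass
  -- of `v m` off `e`.
  have hdev : (κ / 2) ^ 2 * (1 - ξ ^ 2) ≤ ε ^ 2 := by
    have h1 : (κ / 2) ^ 2 ≤ (l m - b) ^ 2 := pow_le_pow_left₀ (by linarith) (by linarith) 2
    have h2 : (κ / 2) ^ 2 ≤ (l m) ^ 2 := pow_le_pow_left₀ (by linarith) (by linarith) 2
    have h3 := mul_le_mul_of_nonneg_right h1 (sq_nonneg ζ)
    have h4 := mul_le_mul_of_nonneg_right h2 hρ
    have h5 : 0 ≤ (l m - a) ^ 2 * ξ ^ 2 := by positivity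
    have h6 : 1 - ξ ^ 2 = ζ ^ 2 + ρ := by linarith
    rw [h6]
    linarith
  have hτ : 1 - ξ ^ 2 ≤ 4 * (ε / κ) ^ 2 := by
    rw [div_pow, ← mul_div_assoc, le_div_iff₀ (by positivity)]
    linarith
  have hεκ : ε / κ ≤ 1 / 8 := by
    rw [div_le_iff₀ hgap0]; linarith
  have hεκ0 : 0 ≤ ε / κ := by positivity
  have hξ1 : 3 / 4 ≤ ξ ^ 2 := by nlinarith
  have hv : ‖v m - e‖ ≤ 3 * (ε / κ) := by
    refine le_of_sq_le_sq ?_ (by positivity)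
    nlinarith
  have hl1 : |l m - a| ≤ 2 * ε := by
    refine abs_le_of_sq_le_sq ?_ (by positivity)
    have h1 : 0 ≤ (l m - b) ^ 2 * ζ ^ 2 := by positivity
    have h2 : 0 ≤ l m ^ 2 * ρ := by positivity
    have h3 : (l m - a) ^ 2 * (3 / 4) ≤ (l m - a) ^ 2 * ξ ^ 2 :=
      mul_le_mul_of_nonneg_left hξ1 (sq_nonneg _)
    rw [mul_pow]
    linarith [sq_nonneg ε]
  -- the second eigenpair
  have hlm' : b - ε ≤ l m' := by
    -- The vector of the plane of `e` and `f` that is orthogonal to `v m`: a test vector for the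
    -- Rayleigh quotient on the complement of `v m`.
    set u := ζ • e - ξ • f with hu
    have hue : inner ℝ e u = ζ := by
      simp only [hu, inner_sub_right, real_inner_smul_right, hee, hef]; ring
    have huf : inner ℝ f u = -ξ := by
      simp only [hu, inner_sub_right, real_inner_smul_right, hfe, hff]; ring
    have huu : ‖u‖ ^ 2 = ζ ^ 2 + ξ ^ 2 := by
      have := norm_sq_add_add he hf hef (r := (0 : Vec k)) (by simp) (by simp) ζ (-ξ) 0
      rw [show ζ • e + (-ξ) • f + (0 : ℝ) • (0 : Vec k) = u by rw [hu]; module] at this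
      rw [this]; simp
    have huv : inner ℝ (v m) u = (0 : ℝ) := by
      rw [hu, inner_sub_right, real_inner_smul_right, real_inner_smul_right,
        real_inner_comm e, real_inner_comm f, ← hξ, ← hζ]
      ring
    have h1 := hquad u
    have h2 := h.inner_le_of_orthogonal_left hB m huv
    rw [hue, huf, huu] at h1
    rw [huu] at h2
    have h3 : 0 < ζ ^ 2 + ξ ^ 2 := by positivity
    have h4 : (b - ε) * (ζ ^ 2 + ξ ^ 2) ≤ l m' * (ζ ^ 2 + ξ ^ 2) := by
      have : 0 ≤ κ * ζ ^ 2 := by positivity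
      have : κ * ζ ^ 2 = a * ζ ^ 2 - b * ζ ^ 2 := by rw [hκ]; ring
      linarith
    exact le_of_mul_le_mul_right h4 h3
  obtain ⟨ρ', hρ', hsum', hbd'⟩ :=
    exists_residual_of_eigenvector he hf hef (h.orthonormal.1 m') (hres m')
  have hη0 : 0 ≤ inner ℝ f (v m') := by rw [real_inner_comm]; exact hal m'
  have hnorm' := norm_sub_sq_le_of_inner_nonneg hf (h.orthonormal.1 m') hη0
  -- No upper bound on `l m'` is available yet, so the residual does not control the component along
  -- `e`. Orthogonality to `v m`, which is close to `e`, does.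
  have hcross : |(inner ℝ e (v m') : ℝ)| ≤ 3 * (ε / κ) := by
    have h1 : inner ℝ (v m) (v m') = (0 : ℝ) := h.orthonormal.2 hne
    have h2 : (inner ℝ e (v m') : ℝ) = -inner ℝ (v m - e) (v m') := by
      rw [inner_sub_left, h1]; ring
    rw [h2, abs_neg]
    refine (abs_real_inner_le_norm _ _).trans ?_
    rw [h.orthonormal.1, mul_one]
    exact hv
  set η : ℝ := inner ℝ f (v m')
  set θ : ℝ := inner ℝ e (v m')
  have hθ2 : θ ^ 2 ≤ 9 * (ε / κ) ^ 2 := by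
    rw [← sq_abs]
    have := pow_le_pow_left₀ (abs_nonneg θ) hcross 2
    rw [mul_pow] at this
    linarith
  have hρ2 : ρ' ≤ 4 * (ε / b) ^ 2 := by
    rw [div_pow, ← mul_div_assoc, le_div_iff₀ (by positivity)]
    have h1 : (b / 2) ^ 2 ≤ (l m') ^ 2 := pow_le_pow_left₀ (by linarith) (by linarith) 2
    have h4 := mul_le_mul_of_nonneg_right h1 hρ'
    have h5 : 0 ≤ (l m' - a) ^ 2 * θ ^ 2 := by positivity
    have h6 : 0 ≤ (l m' - b) ^ 2 * η ^ 2 := by positivity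
    linarith
  have hεb : ε / b ≤ 1 / 8 := by
    rw [div_le_iff₀ hpos0]; linarith
  have hεb0 : 0 ≤ ε / b := by positivity
  have hεκ2 : (ε / κ) ^ 2 ≤ (1 / 8) ^ 2 := pow_le_pow_left₀ hεκ0 hεκ 2
  have hεb2 : (ε / b) ^ 2 ≤ (1 / 8) ^ 2 := pow_le_pow_left₀ hεb0 hεb 2
  have hη1 : 3 / 4 ≤ η ^ 2 := by linarith
  refine ⟨hl1, ?_, hv, ?_⟩
  · refine abs_le_of_sq_le_sq ?_ (by positivity)
    have h1 : 0 ≤ (l m' - a) ^ 2 * θ ^ 2 := by positivity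
    have h2 : 0 ≤ l m' ^ 2 * ρ' := by positivity
    have h3 : (l m' - b) ^ 2 * (3 / 4) ≤ (l m' - b) ^ 2 * η ^ 2 :=
      mul_le_mul_of_nonneg_left hη1 (sq_nonneg _)
    rw [mul_pow]
    linarith [sq_nonneg ε]
  · refine le_of_sq_le_sq ?_ (by positivity)
    have h1 : (5 * (ε / κ + ε / b)) ^ 2
        = 25 * (ε / κ) ^ 2 + 25 * (ε / b) ^ 2 + 50 * (ε / κ * (ε / b)) := by ring
    linarith [mul_nonneg hεκ0 hεb0, sq_nonneg (ε / κ), sq_nonneg (ε / b)]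

/-- Subadditivity of the root. Negative arguments are included, since an empirical radicand may be
negative and its root is then `0`. -/
theorem abs_sqrt_sub_sqrt_le (x y : ℝ) : |√x - √y| ≤ √|x - y| := by
  have key : ∀ x y : ℝ, √x - √y ≤ √|x - y| := by
    intro x y
    have h1 : √x ≤ √(max y 0 + |x - y|) :=
      Real.sqrt_le_sqrt (by linarith [le_max_left y 0, le_abs_self (x - y)])
    have h2 : √(max y 0 + |x - y|) ≤ √(max y 0) + √|x - y| := by
      rw [Real.sqrt_le_left (by positivity)]
      have h4 := Real.sq_sqrt (le_max_right y 0)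
      have h5 := Real.sq_sqrt (abs_nonneg (x - y))
      nlinarith [Real.sqrt_nonneg (max y 0), Real.sqrt_nonneg |x - y|]
    have h3 : √(max y 0) = √y := by
      rcases le_total y 0 with h | h
      · rw [max_eq_right h, Real.sqrt_eq_zero_of_nonpos h, Real.sqrt_zero]
      · rw [max_eq_left h]
    linarith
  rw [abs_le]
  have := key y x
  rw [abs_sub_comm] at this
  exact ⟨by linarith, key x y⟩

theorem abs_delta_sub_le (hp : ∀ b, 0 < p b) (hp1 : p 0 + p 1 = 1) {κ : ℝ} (hκ : 0 < κ)
    (hκ1 : κ ≤ 1) (hq : (p 0 - p 1) ^ 2 ≤ κ ^ 2) (hls : (ls 0 - ls 1) ^ 2 = κ ^ 2)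
    (hl : ∀ b, |l b - ls b| ≤ 2 * ε) (hε : 8 * ε ≤ κ) (b : Fin 2) :
    |Delta p l b - Delta p ls b| ≤ 6 * ε / (κ * p b) := by
  have hpb := hp b
  set d := l b - l b.rev with hd
  set ds := ls b - ls b.rev with hds
  set q := p b - p b.rev with hq'
  have hsum : p b + p b.rev = 1 := by
    fin_cases b
    · exact hp1
    · rw [add_comm]; exact hp1
  have hdd : |d - ds| ≤ 4 * ε := by
    rw [show d - ds = (l b - ls b) - (l b.rev - ls b.rev) by rw [hd, hds]; ring]
    refine (abs_sub _ _).trans ?_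
    linarith [hl b, hl b.rev]
  have hε0 : 0 ≤ ε := by linarith [abs_nonneg (d - ds)]
  have hds2 : |ds| = κ := by
    rw [← abs_of_pos hκ, ← sq_eq_sq_iff_abs_eq_abs, ← hls, hds]
    fin_cases b
    · rfl
    · change (ls 1 - ls 0) ^ 2 = _
      ring
  have hqκ : |q| ≤ κ := by
    refine abs_le_of_sq_le_sq ?_ hκ.le
    refine le_trans (le_of_eq ?_) hq
    rw [hq']
    fin_cases b
    · rfl
    · change (p 1 - p 0) ^ 2 = _
      ring
  have hdκ : κ / 2 ≤ |d| := by
    have h1 := abs_sub_abs_le_abs_sub ds d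
    rw [abs_sub_comm ds d] at h1
    linarith
  have hd0 : d ≠ 0 := by
    rw [← abs_pos]; linarith
  have hds0 : ds ≠ 0 := by
    rw [← abs_pos]; linarith
  -- Because `p b + p b.rev = 1`, the difference of squares is `q`, and `Delta` depends on the
  -- spectral gap `d` only through `d + q / d`. The bound `|q| ≤ κ` makes the variation of `q / d`
  -- of order `ε / κ` instead of `ε / κ²`.
  have form : ∀ t : Fin 2 → ℝ, t b - t b.rev ≠ 0 →
      Delta p t b = -((t b - t b.rev) + q / (t b - t b.rev)) / (2 * p b) := by
    intro t ht
    have ht' : t b.rev - t b ≠ 0 := by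
      intro h0; apply ht; linarith
    have e1 : p b ^ 2 - p b.rev ^ 2 = q := by
      rw [hq']; linear_combination (p b - p b.rev) * hsum
    rw [Delta, add_sub_assoc, e1, ← neg_sub (t b) (t b.rev)]
    field_simp
  rw [form l hd0, form ls hds0, ← hd, ← hds]
  have e2 : -(d + q / d) / (2 * p b) - -(ds + q / ds) / (2 * p b)
      = -((d - ds) - q * (d - ds) / (d * ds)) / (2 * p b) := by
    field_simp
    ring
  rw [e2, abs_div, abs_neg, abs_of_pos (by positivity : 0 < 2 * p b)]
  have h3 : |q * (d - ds) / (d * ds)| ≤ 8 * ε / κ := by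
    rw [abs_div, abs_mul, abs_mul, hds2, div_le_div_iff₀ (by positivity) hκ]
    have h4 : |q| * |d - ds| ≤ κ * (4 * ε) :=
      mul_le_mul hqκ hdd (abs_nonneg _) hκ.le
    have h5 : ε * (κ / 2) ≤ ε * |d| := mul_le_mul_of_nonneg_left hdκ hε0
    nlinarith [mul_le_mul_of_nonneg_right h4 hκ.le, mul_le_mul_of_nonneg_right h5 hκ.le]
  have h6 : 4 * ε ≤ 4 * ε / κ := by
    rw [le_div_iff₀ hκ]; nlinarith
  have h7 := abs_sub (d - ds) (q * (d - ds) / (d * ds))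
  have h8 : |d - ds - q * (d - ds) / (d * ds)| ≤ 12 * ε / κ := by
    have : 12 * ε / κ = 4 * ε / κ + 8 * ε / κ := by ring
    linarith
  calc _ ≤ 12 * ε / κ / (2 * p b) := by gcongr
    _ = 6 * ε / (κ * p b) := by field_simp; ring

theorem IsReference.inSpan (h : IsReference A p β vs ls) : InSpan vs β := by
  have hv := Orthonormal.inner_pair h.1.orthonormal
  have key : ∀ (j : Fin 2) (x y : ℝ), β j = x • vs 0 + y • vs 1 →
      β j = (inner ℝ (vs 0) (β j) : ℝ) • vs 0 + (inner ℝ (vs 1) (β j) : ℝ) • vs 1 := by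
    intro j x y hxy
    have h0 : inner ℝ (vs 0) (β j) = x := by
      rw [hxy]; simp only [inner_add_right, real_inner_smul_right, hv]; ring
    have h1 : inner ℝ (vs 1) (β j) = y := by
      rw [hxy]; simp only [inner_add_right, real_inner_smul_right, hv]; ring
    rw [h0, h1]; exact hxy
  intro j
  fin_cases j
  · exact key 0 _ _ (h.2 0)
  · exact key 1 _ _ ((h.2 1).trans (add_comm _ _))

/-- What remains of `u` after removing its components along `v` is orthogonal to both parameters,
hence annihilated. -/
theorem IsMixtureForm.apply_eq (hA : IsMixtureForm A p β) (hv : Orthonormal ℝ v)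
    (he : ∀ b, Matrix.toEuclideanLin A (v b) = l b • v b) (hs : InSpan v β) (u : Vec k) :
    Matrix.toEuclideanLin A u = (l 0 * inner ℝ (v 0) u) • v 0 + (l 1 * inner ℝ (v 1) u) • v 1 := by
  obtain ⟨h00, h11, h01, h10⟩ := Orthonormal.inner_pair hv
  set r := u - (inner ℝ (v 0) u : ℝ) • v 0 - (inner ℝ (v 1) u : ℝ) • v 1 with hr
  have hr0 : inner ℝ (v 0) r = (0 : ℝ) := by
    rw [hr]; simp only [inner_sub_right, real_inner_smul_right, h00, h01]; ring
  have hr1 : inner ℝ (v 1) r = (0 : ℝ) := by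
    rw [hr]; simp only [inner_sub_right, real_inner_smul_right, h10, h11]; ring
  have hz : ∀ j, inner ℝ (β j) r = (0 : ℝ) := by
    intro j
    rw [hs j, inner_add_left, real_inner_smul_left, real_inner_smul_left, hr0, hr1]
    simp
  have h0 : Matrix.toEuclideanLin A r = 0 := by rw [hA, hz, hz]; simp
  rw [hr, map_sub, map_sub, map_smul, map_smul, he, he, smul_smul, smul_smul] at h0
  rw [mul_comm (l 0), mul_comm (l 1), ← sub_eq_zero, ← h0]
  abel

/-- Each radicand moves by at most `s ^ 2`, so each coefficient by at most `s`; the reference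
coefficients are at most `1`, so eigenvector errors are not amplified. -/
theorem norm_closedForm_sub_le (hv : Orthonormal ℝ v) {s : ℝ} (b : Fin 2)
    (hs : |Delta p l b - Delta p ls b| ≤ 2 * s ^ 2) (hs0 : 0 ≤ s)
    (hls : |Delta p ls b| ≤ 1) :
    ‖closedForm p v l b - closedForm p vs ls b‖ ≤ 2 * s + ‖v b - vs b‖ + ‖v b.rev - vs b.rev‖ := by
  have hc1 : |√((1 - Delta p l b) / 2) - √((1 - Delta p ls b) / 2)| ≤ s := by
    refine (abs_sqrt_sub_sqrt_le _ _).trans ?_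
    rw [Real.sqrt_le_left hs0, show (1 - Delta p l b) / 2 - (1 - Delta p ls b) / 2
      = -((Delta p l b - Delta p ls b) / 2) by ring, abs_neg, abs_div, abs_two]
    linarith
  have hc2 : |√((1 + Delta p l b) / 2) - √((1 + Delta p ls b) / 2)| ≤ s := by
    refine (abs_sqrt_sub_sqrt_le _ _).trans ?_
    rw [Real.sqrt_le_left hs0, show (1 + Delta p l b) / 2 - (1 + Delta p ls b) / 2
      = (Delta p l b - Delta p ls b) / 2 by ring, abs_div, abs_two]
    linarith
  have hb := abs_le.mp hls
  have hd1 : |√((1 - Delta p ls b) / 2)| ≤ 1 := by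
    rw [abs_of_nonneg (Real.sqrt_nonneg _), Real.sqrt_le_one]; linarith
  have hd2 : |√((1 + Delta p ls b) / 2)| ≤ 1 := by
    rw [abs_of_nonneg (Real.sqrt_nonneg _), Real.sqrt_le_one]; linarith
  have hsg : |sgn b| = 1 := by
    unfold sgn; split_ifs <;> simp
  set x := √((1 - Delta p l b) / 2) with hx
  set y := √((1 + Delta p l b) / 2) with hy
  set xs := √((1 - Delta p ls b) / 2) with hxs
  set ys := √((1 + Delta p ls b) / 2) with hys
  have e : closedForm p v l b - closedForm p vs ls b
      = (x - xs) • v b + xs • (v b - vs b)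
        + ((sgn b * (y - ys)) • v b.rev + (sgn b * ys) • (v b.rev - vs b.rev)) := by
    simp only [closedForm, ← hx, ← hy, ← hxs, ← hys]
    module
  rw [e]
  refine (norm_add_le _ _).trans ?_
  have n1 : ‖(x - xs) • v b + xs • (v b - vs b)‖ ≤ s + ‖v b - vs b‖ := by
    refine (norm_add_le _ _).trans (add_le_add ?_ ?_)
    · rw [norm_smul, hv.1, mul_one]; exact hc1
    · rw [norm_smul]; exact mul_le_of_le_one_left (norm_nonneg _) hd1
  have n2 : ‖(sgn b * (y - ys)) • v b.rev + (sgn b * ys) • (v b.rev - vs b.rev)‖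
      ≤ s + ‖v b.rev - vs b.rev‖ := by
    refine (norm_add_le _ _).trans (add_le_add ?_ ?_)
    · rw [norm_smul, hv.1, mul_one, norm_mul, Real.norm_eq_abs, hsg, one_mul]; exact hc2
    · rw [norm_smul, norm_mul, Real.norm_eq_abs (sgn b), hsg, one_mul]
      exact mul_le_of_le_one_left (norm_nonneg _) hd2
  linarith

theorem exists_isAligned (hk : 2 ≤ k) (hB : B.IsHermitian) :
    ∃ v l, IsTopTwoEigenpairs B v l ∧ IsAligned v l vs ls := by
  obtain ⟨v, l, h, hord⟩ : ∃ v l, IsTopTwoEigenpairs B v l ∧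
      0 ≤ (l 0 - l 1) * (ls 0 - ls 1) := by
    obtain ⟨v, l, h⟩ := exists_isTopTwoEigenpairs hk hB
    rcases le_total 0 ((l 0 - l 1) * (ls 0 - ls 1)) with h0 | h0
    · exact ⟨v, l, h, h0⟩
    · refine ⟨_, _, h.comp_rev, ?_⟩
      change 0 ≤ (l 1 - l 0) * (ls 0 - ls 1)
      linarith
  choose s hs1 hs0 using fun b => exists_sign (inner ℝ (v b) (vs b))
  have hw : ∀ b, s b • v b = v b ∨ s b • v b = -v b := by
    intro b
    rcases hs1 b with e | e <;> simp [e]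
  refine ⟨fun b => s b • v b, l, h.of_eq_or_eq_neg hw, hord, fun b => ?_⟩
  rw [real_inner_smul_left]; exact hs0 b

end Perturbation

/-! ### Deterministic error bound for the initialization -/

section Deterministic

variable {k : ℕ} {A B : Matrix (Fin k) (Fin k) ℝ} {p : Fin 2 → ℝ} {β : Fin 2 → Vec k}
  {v vs : Fin 2 → Vec k} {l ls : Fin 2 → ℝ} {c : ℝ}

/-- A positive product has no vanishing factor; `√(1 - κ)` would be `0` as soon as `κ ≥ 1`. -/
theorem kappa_pos_and_deltaTilde_eq (hp : ∀ b, 0 < p b) (hδ : 0 < deltaTilde c p β) :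
    0 < kappa p β ∧ kappa p β < 1 ∧ 0 < ‖β 0 - β 1‖ ∧
      deltaTilde c p β = c ^ 2 * min (p 0) (p 1) ^ 3 * ‖β 0 - β 1‖ ^ 2 * (1 - kappa p β)
        * kappa p β ^ 2 := by
  have hm : 0 < min (p 0) (p 1) := lt_min (hp 0) (hp 1)
  have hne : c * √(min (p 0) (p 1)) ^ 3 * ‖β 0 - β 1‖ * √(1 - kappa p β) * kappa p β ≠ 0 := by
    intro h0
    rw [deltaTilde, h0] at hδ
    simp at hδ
  have hκ : 0 < kappa p β := lt_of_le_of_ne kappa_nonneg fun h => hne (by rw [← h]; ring)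
  have h1 : kappa p β < 1 := by
    by_contra! h
    exact hne (by rw [Real.sqrt_eq_zero_of_nonpos (show 1 - kappa p β ≤ 0 by linarith)]; ring)
  refine ⟨hκ, h1, ?_, ?_⟩
  · refine lt_of_le_of_ne (norm_nonneg _) fun h => hne (by rw [← h]; ring)
  · have e1 : (√(min (p 0) (p 1)) ^ 3) ^ 2 = min (p 0) (p 1) ^ 3 := by
      rw [← pow_mul, mul_comm 3 2, pow_mul, Real.sq_sqrt hm.le]
    rw [deltaTilde, mul_pow, mul_pow, mul_pow, mul_pow, e1, Real.sq_sqrt (by linarith)]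

/-- The allowed error `c q D` is divided evenly: one half for the two eigenvectors, one quarter for
each of the two square roots. -/
theorem err_closedForm_le (hc : 0 < c) (hc2 : c < 1 / 2) (hp : ∀ b, 0 < p b)
    (hp1 : p 0 + p 1 = 1) (hβ : ∀ b, ‖β b‖ = 1) (hδ : 0 < deltaTilde c p β)
    (hA : IsMixtureForm A p β) (hB : B.IsHermitian)
    (hE : ∀ u, ‖Matrix.toEuclideanLin B u - Matrix.toEuclideanLin A u‖
      ≤ deltaTilde c p β / 48 * ‖u‖)
    (href : IsReference A p β vs ls) (h : IsTopTwoEigenpairs B v l) (hal : IsAligned v l vs ls) :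
    err (closedForm p v l) β ≤ c * min (p 0) (p 1) * ‖β 0 - β 1‖ := by
  obtain ⟨hκ, hκ1, hD, hδe⟩ := kappa_pos_and_deltaTilde_eq hp hδ
  have hs := href.inSpan
  have hvs := href.1.orthonormal
  have hadd := hA.eigenvalue_add hvs href.1.eigen hs hβ hp1
  have hsub := hA.eigenvalue_sub_sq hvs href.1.eigen hs hβ hp hp1
  have hq := sq_sub_le_kappa_sq (β := β) hp hp1
  have hm : 0 < min (p 0) (p 1) := lt_min (hp 0) (hp 1)
  have hm2 : min (p 0) (p 1) ≤ 1 / 2 := by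
    rcases le_total (p 0) (p 1) with h | h
    · rw [min_eq_left h]; linarith
    · rw [min_eq_right h]; linarith
  have hD2 : ‖β 0 - β 1‖ ≤ 2 := by
    refine (norm_sub_le _ _).trans ?_
    rw [hβ, hβ]; norm_num
  have hmp : ∀ b, min (p 0) (p 1) ≤ p b := by
    intro b
    fin_cases b
    · exact min_le_left _ _
    · exact min_le_right _ _
  set κ := kappa p β
  set D := ‖β 0 - β 1‖
  set q := min (p 0) (p 1)
  set ε := deltaTilde c p β / 48 with hε
  have hε0 : 0 < ε := by positivity
  have hG : 0 < c * q * D := by positivity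
  -- sizes of the perturbation relative to the gaps
  have hcq : c * q ^ 2 * D ≤ 1 / 4 := by
    have h1 : q ^ 2 ≤ (1 / 2) ^ 2 := pow_le_pow_left₀ hm.le hm2 2
    calc c * q ^ 2 * D ≤ 1 / 2 * (1 / 2) ^ 2 * 2 := by gcongr
      _ = 1 / 4 := by norm_num
  have hK : c ^ 2 * q ^ 3 * D ^ 2 ≤ c * q * D / 4 := by
    have := mul_le_mul_of_nonneg_left hcq hG.le
    linarith
  have hcqD : c * q * D ≤ 1 / 2 := by
    calc c * q * D ≤ 1 / 2 * (1 / 2) * 2 := by gcongr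
      _ = 1 / 2 := by norm_num
  have hεκ : ε / κ ≤ c * q * D / 192 := by
    rw [div_le_iff₀ hκ, hε, hδe]
    have h1 : (1 - κ) * κ ≤ 1 := by nlinarith
    have h2 : c ^ 2 * q ^ 3 * D ^ 2 * ((1 - κ) * κ) ≤ c * q * D / 4 * 1 :=
      mul_le_mul hK h1 (mul_nonneg (by linarith) hκ.le) (by positivity)
    have := mul_le_mul_of_nonneg_right h2 hκ.le
    linarith
  have hεlow : ε / ((1 - κ) / 2) ≤ c * q * D / 96 := by
    rw [div_le_iff₀ (by linarith), hε, hδe]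
    have h1 : κ ^ 2 ≤ 1 := pow_le_one₀ hκ.le hκ1.le
    have h2 : c ^ 2 * q ^ 3 * D ^ 2 * κ ^ 2 ≤ c * q * D / 4 * 1 :=
      mul_le_mul hK h1 (sq_nonneg _) (by positivity)
    have := mul_le_mul_of_nonneg_right h2 (by linarith : 0 ≤ 1 - κ)
    linarith
  have hgap : 8 * ε ≤ κ := by
    have : ε / κ ≤ 1 / 8 := by linarith
    rw [div_le_iff₀ hκ] at this
    linarith
  have hpos : 8 * ε ≤ (1 - κ) / 2 := by
    have : ε / ((1 - κ) / 2) ≤ 1 / 8 := by linarith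
    rw [div_le_iff₀ (by linarith)] at this
    linarith
  obtain ⟨m, hmκ⟩ : ∃ m : Fin 2, ls m - ls m.rev = κ := by
    rcases sq_eq_sq_iff_eq_or_eq_neg.mp hsub with h | h
    · exact ⟨0, h⟩
    · refine ⟨1, ?_⟩
      change ls 1 - ls 0 = κ
      linarith
  have hsum : ls m + ls m.rev = 1 := by
    fin_cases m
    · exact hadd
    · rw [add_comm]; exact hadd
  have hlow : ls m.rev = (1 - κ) / 2 := by linarith
  have hord : l m.rev ≤ l m := by
    have h1 : 0 ≤ (l m - l m.rev) * (ls m - ls m.rev) := by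
      have := hal.1
      fin_cases m
      · exact this
      · change 0 ≤ (l 1 - l 0) * (ls 1 - ls 0)
        linarith
    rw [hmκ] at h1
    have := nonneg_of_mul_nonneg_left h1 hκ
    linarith
  have hE' : ∀ u, ‖Matrix.toEuclideanLin B u - ((ls m * inner ℝ (vs m) u) • vs m
      + (ls m.rev * inner ℝ (vs m.rev) u) • vs m.rev)‖ ≤ ε * ‖u‖ := by
    intro u
    have h1 := hE u
    rw [hA.apply_eq hvs href.1.eigen hs u] at h1
    fin_cases m
    · exact h1
    · rw [add_comm]; exact h1
  obtain ⟨hl1, hl2, hv1, hv2⟩ := h.perturbation hB hvs m hE' hε0.le (by linarith) (by linarith)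
    (by linarith) (by linarith) hord hal.2
  rw [hmκ] at hv1 hv2
  rw [hlow] at hv2
  have hl : ∀ b, |l b - ls b| ≤ 2 * ε := by
    intro b
    have hb : b = m ∨ b = m.rev := by fin_cases m <;> fin_cases b <;> simp
    rcases hb with rfl | rfl
    · exact hl1
    · exact hl2
  have hv : ∀ b, ‖v b - vs b‖ + ‖v b.rev - vs b.rev‖ ≤ c * q * D / 2 := by
    have h0 : ‖v m - vs m‖ + ‖v m.rev - vs m.rev‖ ≤ c * q * D / 2 := by linarith
    intro b
    have hb : b = m ∨ b = m.rev := by fin_cases m <;> fin_cases b <;> simp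
    rcases hb with rfl | rfl
    · exact h0
    · rw [Fin.rev_rev, add_comm]; exact h0
  have hne : ls 0 ≠ ls 1 := by
    intro h0
    rw [h0, sub_self] at hsub
    have : 0 < κ ^ 2 := by positivity
    linarith
  have hΔ : ∀ b, |Delta p ls b| ≤ 1 := by
    obtain ⟨d0, d1⟩ := hA.delta_eq hvs href.1.eigen hs hβ hp hne
    have h2 := hs.sq_add_sq hβ 0
    have h3 := hs.sq_add_sq hβ 1
    intro b
    rw [abs_le]
    fin_cases b
    · change -1 ≤ Delta p ls 0 ∧ Delta p ls 0 ≤ 1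
      rw [d0]
      constructor <;> linarith [sq_nonneg (inner ℝ (vs 0) (β 0) : ℝ),
        sq_nonneg (inner ℝ (vs 1) (β 0) : ℝ)]
    · change -1 ≤ Delta p ls 1 ∧ Delta p ls 1 ≤ 1
      rw [d1]
      constructor <;> linarith [sq_nonneg (inner ℝ (vs 0) (β 1) : ℝ),
        sq_nonneg (inner ℝ (vs 1) (β 1) : ℝ)]
  have key : ∀ b, ‖closedForm p v l b - β b‖ ≤ c * q * D := by
    intro b
    have h1 := abs_delta_sub_le hp hp1 hκ hκ1.le hq hsub hl hgap b
    -- The origin of the `48`: `6 ε = δ̃ / 8`, and the right-hand side is `(c q D)² / 8`. Beyond the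
    -- squared target, `δ̃` keeps a factor `q` to absorb `1 / p b` and a factor `κ` to absorb `1 /
    -- κ`.
    have h2 : 6 * ε / (κ * p b) ≤ 2 * (c * q * D / 4) ^ 2 := by
      have hpb := hp b
      rw [div_le_iff₀ (by positivity), hε, hδe]
      have h3 : (1 - κ) * κ ≤ 1 := by nlinarith
      have h4 : q * ((1 - κ) * κ) ≤ p b * 1 :=
        mul_le_mul (hmp b) h3 (mul_nonneg (by linarith) hκ.le) hpb.le
      have := mul_le_mul_of_nonneg_left h4 (by positivity : 0 ≤ c ^ 2 * q ^ 2 * D ^ 2 * κ)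
      linarith
    have h5 := norm_closedForm_sub_le (vs := vs) h.orthonormal b (h1.trans h2) (by positivity)
      (hΔ b)
    rw [← href.2 b] at h5
    linarith [hv b]
  exact max_le (key 0) (key 1)

/-- Dependent unit vectors have `⟨β₀,β₁⟩² = 1`, hence `κ = 1`. Independence also forces the
dimension to be at least `2`. -/
theorem linearIndependent_of_deltaTilde_pos (hp : ∀ b, 0 < p b)
    (hp1 : p 0 + p 1 = 1) (hβ : ∀ b, ‖β b‖ = 1) (hδ : 0 < deltaTilde c p β) :
    LinearIndependent ℝ β := by
  obtain ⟨hκ, hκ1, -, -⟩ := kappa_pos_and_deltaTilde_eq hp hδ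
  rw [linearIndependent_fin2]
  refine ⟨fun h0 => ?_, fun a ha => ?_⟩
  · have := hβ 1
    rw [h0] at this
    simp at this
  · have h1 : |a| = 1 := by
      have := hβ 0
      rwa [← ha, norm_smul, hβ, mul_one] at this
    have h2 : (inner ℝ (β 0) (β 1) : ℝ) ^ 2 = 1 := by
      rw [← ha, real_inner_smul_left, real_inner_self_eq_norm_sq, hβ, one_pow, mul_one, ← sq_abs,
        h1, one_pow]
    have h3 := kappa_sq (β := β) hp hp1
    rw [h2] at h3
    nlinarith

theorem two_le_of_linearIndependent (hi : LinearIndependent ℝ β) : 2 ≤ k := by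
  simpa using hi.fintype_card_le_finrank

end Deterministic

/-! ### Nets and operator norms -/

section Net

variable {E : Type*} [NormedAddCommGroup E] [InnerProductSpace ℝ E] [FiniteDimensional ℝ E]

variable (E) in
/-- The unit ball of a `d`-dimensional space has a `1/2`-net with at most `5 ^ d` points. -/
theorem exists_half_net : ∃ T : Finset E, T.card ≤ 5 ^ Module.finrank ℝ E ∧
    (∀ u ∈ T, ‖u‖ ≤ 1) ∧ ∀ u : E, ‖u‖ ≤ 1 → ∃ w ∈ T, ‖u - w‖ ≤ 1 / 2 := by
  classical
  let Sep : Finset E → Prop := fun s =>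
    (∀ c ∈ s, ‖c‖ ≤ 2) ∧ ∀ c ∈ s, ∀ d ∈ s, c ≠ d → 1 ≤ ‖c - d‖
  have hbd : ∀ s, Sep s → s.card ≤ 5 ^ Module.finrank ℝ E := fun s hs =>
    Besicovitch.card_le_of_separated s hs.1 hs.2
  -- A `1`-separated set of maximal cardinality in the ball of radius `2`: maximality makes it a
  -- `1`-net, and halving it gives the net of the unit ball.
  obtain ⟨s, hs, hmax⟩ : ∃ s, Sep s ∧ ∀ s', Sep s' → s'.card ≤ s.card := by
    let P : ℕ → Prop := fun n => ∃ s, Sep s ∧ s.card = n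
    have h0 : P 0 := ⟨∅, by simp [Sep], rfl⟩
    obtain ⟨s, hs, hcard⟩ := Nat.findGreatest_spec (P := P) (n := 5 ^ Module.finrank ℝ E)
      (Nat.zero_le _) h0
    exact ⟨s, hs, fun s' hs' => by
      rw [hcard]
      exact Nat.le_findGreatest (hbd s' hs') ⟨s', hs', rfl⟩⟩
  have hcov : ∀ u : E, ‖u‖ ≤ 2 → ∃ c ∈ s, ‖u - c‖ < 1 := by
    intro u hu
    by_contra! hcon
    have hus : u ∉ s := by
      intro hus
      have := hcon u hus
      simp at this
      linarith
    have hins : Sep (insert u s) := by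
      refine ⟨?_, ?_⟩
      · intro c hc
        rcases Finset.mem_insert.mp hc with rfl | hc
        · exact hu
        · exact hs.1 c hc
      · intro c hc d hd hcd
        rcases Finset.mem_insert.mp hc with rfl | hc' <;>
          rcases Finset.mem_insert.mp hd with rfl | hd'
        · exact absurd rfl hcd
        · exact hcon d hd'
        · rw [norm_sub_rev]; exact hcon c hc'
        · exact hs.2 c hc' d hd' hcd
    have := hmax _ hins
    rw [Finset.card_insert_of_notMem hus] at this
    omega
  refine ⟨s.image fun c => (1 / 2 : ℝ) • c, Finset.card_image_le.trans (hbd s hs), ?_, ?_⟩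
  · intro u hu
    obtain ⟨c, hc, rfl⟩ := Finset.mem_image.mp hu
    rw [norm_smul]
    have := hs.1 c hc
    norm_num
    linarith
  · intro u hu
    obtain ⟨c, hc, hlt⟩ := hcov ((2 : ℝ) • u) (by rw [norm_smul]; norm_num; linarith)
    refine ⟨_, Finset.mem_image_of_mem _ hc, ?_⟩
    rw [show u - (1 / 2 : ℝ) • c = (1 / 2 : ℝ) • ((2 : ℝ) • u - c) by module, norm_smul]
    norm_num
    linarith

variable (E) in
/-- The norm of a symmetric operator is controlled by its quadratic form on a finite set. -/
theorem exists_testing_set : ∃ T : Finset E, T.card ≤ 2 * 25 ^ Module.finrank ℝ E ∧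
    (∀ u ∈ T, ‖u‖ ≤ 1) ∧ ∀ S : E →ₗ[ℝ] E, S.IsSymmetric → ∀ t : ℝ,
      (∀ u ∈ T, |inner ℝ u (S u)| ≤ t) → ∀ u, ‖S u‖ ≤ 8 * t * ‖u‖ := by
  classical
  obtain ⟨T, hcard, hT1, hnet⟩ := exists_half_net E
  -- Half sums and half differences of net points: by polarization the quadratic form on them
  -- controls the bilinear form on the net.
  let P : Finset E := (T ×ˢ T).image fun w => (1 / 2 : ℝ) • (w.1 + w.2)
  let M : Finset E := (T ×ˢ T).image fun w => (1 / 2 : ℝ) • (w.1 - w.2)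
  have hTT : (T ×ˢ T).card ≤ 25 ^ Module.finrank ℝ E := by
    rw [Finset.card_product]
    calc T.card * T.card ≤ 5 ^ Module.finrank ℝ E * 5 ^ Module.finrank ℝ E :=
          Nat.mul_le_mul hcard hcard
      _ = 25 ^ Module.finrank ℝ E := by rw [← mul_pow]; norm_num
  refine ⟨P ∪ M, ?_, ?_, ?_⟩
  · refine (Finset.card_union_le _ _).trans ?_
    have h1 : P.card ≤ _ := Finset.card_image_le.trans hTT
    have h2 : M.card ≤ _ := Finset.card_image_le.trans hTT
    omega
  · intro u hu
    rcases Finset.mem_union.mp hu with hu | hu <;>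
    · obtain ⟨w, hw, rfl⟩ := Finset.mem_image.mp hu
      have h1 := hT1 _ (Finset.mem_product.mp hw).1
      have h2 := hT1 _ (Finset.mem_product.mp hw).2
      rw [norm_smul]
      have h3 := norm_add_le w.1 w.2
      have h4 := norm_sub_le w.1 w.2
      norm_num
      linarith
  · intro S hS t ht
    have hbil : ∀ u ∈ T, ∀ w ∈ T, |inner ℝ u (S w)| ≤ 2 * t := by
      intro u hu w hw
      have hmem : (u, w) ∈ T ×ˢ T := Finset.mem_product.mpr ⟨hu, hw⟩
      have h1 := ht _ (Finset.mem_union_left _ (Finset.mem_image_of_mem _ hmem))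
      have h2 := ht _ (Finset.mem_union_right _ (Finset.mem_image_of_mem _ hmem))
      have h3 : (inner ℝ w (S u) : ℝ) = inner ℝ u (S w) := by
        rw [← hS, real_inner_comm]
      have e : (inner ℝ u (S w) : ℝ)
          = inner ℝ ((1 / 2 : ℝ) • (u + w)) (S ((1 / 2 : ℝ) • (u + w)))
            - inner ℝ ((1 / 2 : ℝ) • (u - w)) (S ((1 / 2 : ℝ) • (u - w))) := by
        simp only [map_smul, map_add, map_sub, real_inner_smul_left, real_inner_smul_right,
          inner_add_left, inner_add_right, inner_sub_left, inner_sub_right, h3]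
        ring
      rw [e]
      refine (abs_sub _ _).trans ?_
      simp only at h1 h2
      linarith
    have hvec : ∀ w ∈ T, ‖S w‖ ≤ 4 * t := by
      intro w hw
      set y := S w with hy
      by_cases hy0 : y = 0
      · obtain ⟨u, hu, -⟩ := hnet 0 (by simp)
        have := (abs_nonneg _).trans (hbil u hu w hw)
        rw [hy0, norm_zero]; linarith
      have hyp : 0 < ‖y‖ := norm_pos_iff.mpr hy0
      obtain ⟨u, hu, hd⟩ := hnet (‖y‖⁻¹ • y) (by rw [norm_smul, norm_inv, norm_norm]; field_simp; rfl)
      have h1 := (abs_le.mp (hbil u hu w hw)).2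
      have h2 := real_inner_le_norm (‖y‖⁻¹ • y - u) y
      rw [inner_sub_left, real_inner_smul_left, real_inner_self_eq_norm_sq] at h2
      have h3 : ‖y‖⁻¹ * ‖y‖ ^ 2 = ‖y‖ := by field_simp
      rw [h3] at h2
      have h4 := mul_le_mul_of_nonneg_right hd hyp.le
      rw [← hy] at h1
      linarith
    set S' := LinearMap.toContinuousLinearMap S with hS'
    have hS'S : ∀ u, S' u = S u := fun _ => rfl
    have ht0 : 0 ≤ t := by
      obtain ⟨u, hu, -⟩ := hnet 0 (by simp)
      have := (abs_nonneg _).trans (hbil u hu u hu)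
      linarith
    -- A unit vector is within `1/2` of a net point, so the norm reappears on the right with factor
    -- `1/2` and is absorbed; this gives `8 t`.
    have hop : ‖S'‖ ≤ 4 * t + ‖S'‖ * (1 / 2) := by
      refine ContinuousLinearMap.opNorm_le_of_unit_norm (𝕜 := ℝ) (by positivity) fun u hu => ?_
      obtain ⟨w, hw, hd⟩ := hnet u hu.le
      have h1 : S' u = S w + S' (u - w) := by rw [map_sub, hS'S w]; abel
      rw [h1]
      refine (norm_add_le _ _).trans (add_le_add (hvec w hw) ?_)
      exact (S'.le_opNorm _).trans (mul_le_mul_of_nonneg_left hd (norm_nonneg _))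
    intro u
    calc ‖S u‖ = ‖S' u‖ := rfl
      _ ≤ ‖S'‖ * ‖u‖ := S'.le_opNorm u
      _ ≤ 8 * t * ‖u‖ := by gcongr; linarith

end Net

/-! ### Moments of Gaussian vectors -/

section Gaussian

open scoped NNReal

theorem integral_pow_four_gaussianReal (v : ℝ≥0) : ∫ x, x ^ 4 ∂gaussianReal 0 v = 3 * (v : ℝ) ^ 2 := by
  have h1 : ∫ x, x ^ 4 ∂gaussianReal 0 v
      = iteratedDeriv 4 (mgf (fun x ↦ x) (gaussianReal 0 v)) 0 := by
    rw [iteratedDeriv_mgf_zero] <;> simp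
  rw [h1, mgf_fun_id_gaussianReal]
  simp only [zero_mul, zero_add]
  set w : ℝ := (↑v : ℝ)
  have he : ∀ t : ℝ, HasDerivAt (fun t => Real.exp (w * t ^ 2 / 2))
      (w * t * Real.exp (w * t ^ 2 / 2)) t := by
    intro t
    have := (((hasDerivAt_pow 2 t).const_mul w).div_const 2).exp
    convert this using 1
    simp
    ring
  have d1 : deriv (fun t : ℝ => Real.exp (w * t ^ 2 / 2))
      = fun t => w * t * Real.exp (w * t ^ 2 / 2) := funext fun t => (he t).deriv
  have d2 : deriv (fun t : ℝ => w * t * Real.exp (w * t ^ 2 / 2))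
      = fun t => (w + w ^ 2 * t ^ 2) * Real.exp (w * t ^ 2 / 2) := funext fun t => by
    have := ((hasDerivAt_id t).const_mul w).mul (he t)
    refine (this.congr_deriv ?_).deriv
    simp; ring
  have d3 : deriv (fun t : ℝ => (w + w ^ 2 * t ^ 2) * Real.exp (w * t ^ 2 / 2))
      = fun t => (3 * w ^ 2 * t + w ^ 3 * t ^ 3) * Real.exp (w * t ^ 2 / 2) := funext fun t => by
    have := (((hasDerivAt_pow 2 t).const_mul (w ^ 2)).const_add w).mul (he t)
    refine (this.congr_deriv ?_).deriv
    simp; ring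
  have d4 : deriv (fun t : ℝ => (3 * w ^ 2 * t + w ^ 3 * t ^ 3) * Real.exp (w * t ^ 2 / 2)) 0
      = 3 * w ^ 2 := by
    have := (((hasDerivAt_id (0 : ℝ)).const_mul (3 * w ^ 2)).add
      ((hasDerivAt_pow 3 (0 : ℝ)).const_mul (w ^ 3))).mul (he 0)
    refine (this.congr_deriv ?_).deriv
    simp
  rw [iteratedDeriv_succ, iteratedDeriv_succ, iteratedDeriv_succ, iteratedDeriv_one, d1, d2, d3, d4]

/-- For `v ≠ 0` a Gaussian integral with rate `b = 1/(2v) - 1/4 ≥ 1/4`, of value `(1 - v/2)^(-1/2) ≤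
√2`. Variance `0` is a Dirac mass and is treated apart. -/
theorem exp_sq_div_four_gaussianReal {v : ℝ≥0} (hv : v ≤ 1) :
    Integrable (fun x => Real.exp (x ^ 2 / 4)) (gaussianReal 0 v) ∧
      ∫ x, Real.exp (x ^ 2 / 4) ∂gaussianReal 0 v ≤ 2 := by
  rcases eq_or_ne v 0 with rfl | h0
  · rw [gaussianReal_zero_var]
    constructor
    · exact integrable_dirac (by simp)
    · rw [integral_dirac]; simp
  have hv0 : 0 < (v : ℝ) := by positivity
  have hv1 : (v : ℝ) ≤ 1 := hv
  set b : ℝ := 1 / (2 * v) - 1 / 4 with hb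
  have hbpos : 1 / 4 ≤ b := by
    have : 1 / 2 ≤ 1 / (2 * (v : ℝ)) := by
      rw [div_le_div_iff₀ (by norm_num) (by positivity)]; linarith
    linarith
  have hpt : ∀ x : ℝ, gaussianPDFReal 0 v x * Real.exp (x ^ 2 / 4)
      = (√(2 * Real.pi * v))⁻¹ * Real.exp (-b * x ^ 2) := by
    intro x
    rw [gaussianPDFReal_def]
    simp only
    rw [mul_assoc, ← Real.exp_add]
    congr 2
    rw [hb]
    field_simp
    ring
  constructor
  · rw [gaussianReal_of_var_ne_zero _ h0]
    rw [integrable_withDensity_iff (measurable_gaussianPDF _ _)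
      (ae_of_all _ fun _ => gaussianPDF_lt_top)]
    have : (fun x => Real.exp (x ^ 2 / 4) * (gaussianPDF 0 v x).toReal)
        = fun x => (√(2 * Real.pi * v))⁻¹ * Real.exp (-b * x ^ 2) := by
      funext x
      rw [toReal_gaussianPDF, mul_comm, hpt]
    rw [this]
    exact (integrable_exp_neg_mul_sq (by linarith)).const_mul _
  · rw [integral_gaussianReal_eq_integral_smul h0]
    simp only [smul_eq_mul, hpt]
    rw [integral_const_mul, integral_gaussian, inv_mul_le_iff₀ (by positivity)]
    rw [Real.sqrt_le_left (by positivity), mul_pow, Real.sq_sqrt (by positivity),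
      div_le_iff₀ (by linarith)]
    have : 2 * Real.pi * v * 2 ^ 2 * b = 4 * Real.pi - 2 * Real.pi * v := by
      rw [hb]; field_simp; ring
    rw [this]
    nlinarith [Real.pi_pos]

variable {E : Type*} [NormedAddCommGroup E] [InnerProductSpace ℝ E] [FiniteDimensional ℝ E]
  [MeasurableSpace E] [BorelSpace E]

theorem stdGaussian_map_inner (u : E) :
    (stdGaussian E).map (fun x => inner ℝ x u) = gaussianReal 0 (‖u‖₊ ^ 2) := by
  have h := IsGaussian.map_eq_gaussianReal (μ := stdGaussian E) (innerSL ℝ u)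
  rw [integral_strongDual_stdGaussian, variance_dual_stdGaussian, innerSL_apply_norm] at h
  have e : (fun x => inner ℝ x u : E → ℝ) = innerSL ℝ u := by
    funext x
    rw [innerSL_apply_apply, real_inner_comm]
  rw [e, h]
  congr 1
  ext
  simp

theorem integrable_inner_pow (u : E) (n : ℕ) :
    Integrable (fun x => (inner ℝ x u : ℝ) ^ n) (stdGaussian E) := by
  have h : Integrable (fun x : ℝ => x ^ n) ((stdGaussian E).map (fun x => inner ℝ x u)) := by
    rw [stdGaussian_map_inner]
    rcases eq_or_ne n 0 with rfl | hn
    · simp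
    · have := (memLp_id_gaussianReal (μ := 0) (v := ‖u‖₊ ^ 2) n).integrable_norm_pow hn
      exact (this.congr' (by fun_prop) (by simp))
  exact h.comp_measurable (by fun_prop)

theorem integral_inner_pow_four (u : E) :
    ∫ x, (inner ℝ x u : ℝ) ^ 4 ∂stdGaussian E = 3 * ‖u‖ ^ 4 := by
  have h : ∫ x, (inner ℝ x u : ℝ) ^ 4 ∂stdGaussian E
      = ∫ y, y ^ 4 ∂(stdGaussian E).map (fun x => inner ℝ x u) := by
    rw [integral_map (by fun_prop) (by fun_prop)]
  rw [h, stdGaussian_map_inner, integral_pow_four_gaussianReal]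
  push_cast
  simp
  ring

theorem exp_inner_sq_div_four {u : E} (hu : ‖u‖ ≤ 1) :
    Integrable (fun x => Real.exp ((inner ℝ x u : ℝ) ^ 2 / 4)) (stdGaussian E) ∧
      ∫ x, Real.exp ((inner ℝ x u : ℝ) ^ 2 / 4) ∂stdGaussian E ≤ 2 := by
  have hv : ‖u‖₊ ^ 2 ≤ 1 := pow_le_one₀ (by positivity) hu
  obtain ⟨h1, h2⟩ := exp_sq_div_four_gaussianReal hv
  rw [← stdGaussian_map_inner] at h1 h2
  rw [integral_map (by fun_prop) (by fun_prop)] at h2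
  exact ⟨h1.comp_measurable (by fun_prop), h2⟩

/-- Reduces mixed fourth moments to fourth powers of single linear forms, whose laws are
one-dimensional Gaussians. -/
theorem polarization_four (a b c : ℝ) : a ^ 2 * (b * c) =
    (1 / 48) * ((a + (b + c)) ^ 4 + (a - (b + c)) ^ 4 - 2 * (b + c) ^ 4)
      - (1 / 48) * ((a + (b - c)) ^ 4 + (a - (b - c)) ^ 4 - 2 * (b - c) ^ 4) := by
  ring

/-- Fourth moments of a standard Gaussian vector. -/
theorem integral_inner_sq_mul_inner_mul_inner (a b c : E) :
    Integrable (fun x => (inner ℝ x a : ℝ) ^ 2 * (inner ℝ x b * inner ℝ x c)) (stdGaussian E) ∧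
      ∫ x, (inner ℝ x a : ℝ) ^ 2 * (inner ℝ x b * inner ℝ x c) ∂stdGaussian E
        = ‖a‖ ^ 2 * inner ℝ b c + 2 * (inner ℝ a b * inner ℝ a c) := by
  have hform : (fun x => (inner ℝ x a : ℝ) ^ 2 * (inner ℝ x b * inner ℝ x c)) = fun x : E =>
      (1 / 48) * ((inner ℝ x (a + (b + c)) : ℝ) ^ 4 + (inner ℝ x (a - (b + c)) : ℝ) ^ 4
        - 2 * (inner ℝ x (b + c) : ℝ) ^ 4)
      - (1 / 48) * ((inner ℝ x (a + (b - c)) : ℝ) ^ 4 + (inner ℝ x (a - (b - c)) : ℝ) ^ 4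
        - 2 * (inner ℝ x (b - c) : ℝ) ^ 4) := by
    funext x
    rw [polarization_four]
    simp only [inner_add_right, inner_sub_right]
  have I := fun u : E => integrable_inner_pow u 4
  have hi : ∀ b' : E, Integrable (fun x => (1 / 48) * ((inner ℝ x (a + b') : ℝ) ^ 4
      + (inner ℝ x (a - b') : ℝ) ^ 4 - 2 * (inner ℝ x b' : ℝ) ^ 4)) (stdGaussian E) :=
    fun b' => (((I _).add (I _)).sub ((I _).const_mul 2)).const_mul _
  have hval : ∀ b' : E, ∫ x, (1 / 48) * ((inner ℝ x (a + b') : ℝ) ^ 4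
      + (inner ℝ x (a - b') : ℝ) ^ 4 - 2 * (inner ℝ x b' : ℝ) ^ 4) ∂stdGaussian E
      = (1 / 48) * (3 * ‖a + b'‖ ^ 4 + 3 * ‖a - b'‖ ^ 4 - 2 * (3 * ‖b'‖ ^ 4)) := by
    intro b'
    have h2 : Integrable (fun x => (inner ℝ x (a + b') : ℝ) ^ 4 + (inner ℝ x (a - b') : ℝ) ^ 4)
        (stdGaussian E) := (I _).add (I _)
    rw [integral_const_mul, integral_sub h2 ((I _).const_mul 2),
      integral_add (I _) (I _), integral_const_mul, integral_inner_pow_four,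
      integral_inner_pow_four, integral_inner_pow_four]
  rw [hform]
  refine ⟨(hi _).sub (hi _), ?_⟩
  rw [integral_sub (hi _) (hi _), hval, hval]
  have hn : ∀ u : E, ‖u‖ ^ 4 = (inner ℝ u u : ℝ) ^ 2 := by
    intro u
    rw [real_inner_self_eq_norm_sq]; ring
  rw [hn, hn, hn, hn, hn, hn, ← real_inner_self_eq_norm_sq]
  simp only [inner_add_left, inner_add_right, inner_sub_left, inner_sub_right,
    real_inner_comm a b, real_inner_comm a c, real_inner_comm b c]
  ring

end Gaussian

/-! ### Entries and quadratic form of the empirical matrix -/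

section EmpiricalMatrix

variable {Ω : Type*} {k N : ℕ} {β : Fin 2 → Vec k} {x : Fin N → Ω → Vec k} {z : Fin N → Ω → Bool}

theorem empMatrix_apply (ω : Ω) (a b : Fin k) :
    empMatrix β x z ω a b = 1 / 2 * (1 / (N : ℝ) * ∑ i, response β (x i ω) (z i ω) ^ 2
      * (x i ω a * x i ω b) - (1 : Matrix (Fin k) (Fin k) ℝ) a b) := by
  simp [empMatrix, momentMatrix, Matrix.sum_apply, Matrix.vecMulVec_apply]

theorem inner_toEuclideanLin (M : Matrix (Fin k) (Fin k) ℝ) (u w : Vec k) :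
    inner ℝ u (Matrix.toEuclideanLin M w) = ∑ a, ∑ b, u a * w b * M a b := by
  simp only [PiLp.inner_apply, Matrix.ofLp_toLpLin, Matrix.toLin'_apply, Matrix.mulVec, dotProduct,
    RCLike.inner_apply, conj_trivial, Finset.sum_mul]
  refine Finset.sum_congr rfl fun a _ => Finset.sum_congr rfl fun b _ => ?_
  ring

theorem inner_empMatrix (ω : Ω) (u : Vec k) :
    inner ℝ u (Matrix.toEuclideanLin (empMatrix β x z ω) u)
      = 1 / 2 * (1 / (N : ℝ) * ∑ i, response β (x i ω) (z i ω) ^ 2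
        * (inner ℝ (x i ω) u * inner ℝ (x i ω) u) - inner ℝ u u) := by
  have h1 : ∀ i, (inner ℝ u (Matrix.toEuclideanLin (Matrix.vecMulVec (x i ω) (x i ω)) u) : ℝ)
      = inner ℝ (x i ω) u * inner ℝ (x i ω) u := by
    intro i
    rw [inner_toEuclideanLin]
    simp only [PiLp.inner_apply, RCLike.inner_apply, conj_trivial, Matrix.vecMulVec_apply]
    rw [Finset.sum_mul_sum]
    refine Finset.sum_congr rfl fun a _ => Finset.sum_congr rfl fun b _ => ?_
    ring
  have h2 : Matrix.toEuclideanLin (1 : Matrix (Fin k) (Fin k) ℝ) u = u := by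
    ext a; simp
  simp only [empMatrix, momentMatrix, map_smul, map_sub, map_sum, LinearMap.smul_apply,
    LinearMap.sub_apply, LinearMap.sum_apply, real_inner_smul_right, inner_sub_right,
    inner_sum, h1, h2]

theorem empMatrix_isHermitian (ω : Ω) : (empMatrix β x z ω).IsHermitian := by
  ext a b
  rw [Matrix.conjTranspose_apply, star_trivial, empMatrix_apply, empMatrix_apply]
  simp only [mul_comm (x _ ω b), Matrix.one_apply, eq_comm]

end EmpiricalMatrix

/-! ### Expectation of the empirical matrix -/

section Population

variable {Ω : Type*} [MeasurableSpace Ω] {μ : Measure Ω}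
  {k N : ℕ} {p : Fin 2 → ℝ} {β : Fin 2 → Vec k} {x : Fin N → Ω → Vec k} {z : Fin N → Ω → Bool}

theorem IsSample.integrable_comp (h : IsSample μ p x z) (i : Fin N) {f : Vec k → ℝ}
    (hf : Integrable f (stdGaussian (Vec k))) : Integrable (fun ω => f (x i ω)) μ := by
  rw [← h.law_x i] at hf
  exact hf.comp_measurable (h.measurable_x i)

theorem IsSample.integral_comp (h : IsSample μ p x z) (i : Fin N) {f : Vec k → ℝ}
    (hf : Measurable f) : ∫ ω, f (x i ω) ∂μ = ∫ a, f a ∂stdGaussian (Vec k) := by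
  rw [← h.law_x i, integral_map (h.measurable_x i).aemeasurable hf.aestronglyMeasurable]

/-- The value `1` at the label `true`, and `0` at the label `false`. -/
def labelIndicator (b : Bool) : ℝ := if b then 1 else 0

theorem IsSample.integral_labelIndicator (h : IsSample μ p x z) (i : Fin N) :
    ∫ ω, labelIndicator (z i ω) ∂μ = μ.real {ω | z i ω = true} := by
  have e : (fun ω => labelIndicator (z i ω)) = Set.indicator {ω | z i ω = true} 1 := by
    funext ω
    by_cases hz : z i ω = true <;> simp [labelIndicator, Set.indicator, hz]
  rw [e, integral_indicator_one]
  exact h.measurable_z i (measurableSet_singleton true)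

theorem IsSample.integrable_labelIndicator [IsProbabilityMeasure μ] (h : IsSample μ p x z) (i : Fin N) :
    Integrable (fun ω => labelIndicator (z i ω)) μ := by
  refine Integrable.of_bound (C := 1)
    ((measurable_of_countable labelIndicator).comp (h.measurable_z i)).aestronglyMeasurable
    (ae_of_all _ fun ω => ?_)
  unfold labelIndicator
  split_ifs <;> simp

theorem IsSample.integral_comp_mul_labelIndicator [IsProbabilityMeasure μ] (h : IsSample μ p x z)
    (i : Fin N) {f : Vec k → ℝ} (hf : Integrable f (stdGaussian (Vec k))) (hfm : Measurable f) :
    Integrable (fun ω => f (x i ω) * labelIndicator (z i ω)) μ ∧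
      ∫ ω, f (x i ω) * labelIndicator (z i ω) ∂μ
        = (∫ a, f a ∂stdGaussian (Vec k)) * μ.real {ω | z i ω = true} := by
  have hind : IndepFun (fun ω => f (x i ω)) (fun ω => labelIndicator (z i ω)) μ :=
    (h.indep_label i).comp hfm (measurable_of_countable labelIndicator)
  have i1 := h.integrable_comp i hf
  have i2 := h.integrable_labelIndicator i
  refine ⟨hind.integrable_mul i1 i2, ?_⟩
  rw [hind.integral_fun_mul_eq_mul_integral i1.aestronglyMeasurable i2.aestronglyMeasurable,
    h.integral_comp i hfm, h.integral_labelIndicator]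

/-- Written with the label indicator, the squared response is a combination of functions of the
covariate and products of such functions with the indicator; independence of covariate and label
factors the expectation. -/
theorem IsSample.moment [IsProbabilityMeasure μ] (h : IsSample μ p x z)
    (hβ : ∀ b, ‖β b‖ = 1) (i : Fin N) (u w : Vec k) :
    Integrable (fun ω => response β (x i ω) (z i ω) ^ 2
        * (inner ℝ (x i ω) u * inner ℝ (x i ω) w)) μ ∧
      ∫ ω, response β (x i ω) (z i ω) ^ 2 * (inner ℝ (x i ω) u * inner ℝ (x i ω) w) ∂μ
        = μ.real {ω | z i ω = true}
            * (inner ℝ u w + 2 * (inner ℝ (β 0) u * inner ℝ (β 0) w))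
          + (1 - μ.real {ω | z i ω = true})
            * (inner ℝ u w + 2 * (inner ℝ (β 1) u * inner ℝ (β 1) w)) := by
  set f : Fin 2 → Vec k → ℝ := fun b a =>
    (inner ℝ a (β b) : ℝ) ^ 2 * (inner ℝ a u * inner ℝ a w) with hf
  have hfm : ∀ b, Measurable (f b) := fun b => by simp only [hf]; fun_prop
  have hfi : ∀ b, Integrable (f b) (stdGaussian (Vec k)) := fun b =>
    (integral_inner_sq_mul_inner_mul_inner (β b) u w).1
  have hfv : ∀ b, ∫ a, f b a ∂stdGaussian (Vec k)
      = inner ℝ u w + 2 * (inner ℝ (β b) u * inner ℝ (β b) w) := fun b => by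
    rw [(integral_inner_sq_mul_inner_mul_inner (β b) u w).2, hβ]; ring
  have e : (fun ω => response β (x i ω) (z i ω) ^ 2 * (inner ℝ (x i ω) u * inner ℝ (x i ω) w))
      = fun ω => f 1 (x i ω) + f 0 (x i ω) * labelIndicator (z i ω)
        - f 1 (x i ω) * labelIndicator (z i ω) := by
    funext ω
    cases hz : z i ω <;> simp [hf, response, labelIndicator]
  obtain ⟨i0, v0⟩ := h.integral_comp_mul_labelIndicator i (hfi 0) (hfm 0)
  obtain ⟨i1, v1⟩ := h.integral_comp_mul_labelIndicator i (hfi 1) (hfm 1)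
  have i2 := h.integrable_comp i (hfi 1)
  have i3 : Integrable (fun ω => f 1 (x i ω) + f 0 (x i ω) * labelIndicator (z i ω)) μ :=
    i2.add i0
  rw [e]
  refine ⟨i3.sub i1, ?_⟩
  rw [integral_sub i3 i1, integral_add i2 i0, v0, v1, h.integral_comp i (hfm 1), hfv, hfv]
  ring

/-- Individual label probabilities enter linearly, so only their average `p 0` survives; the labels
need not be identically distributed. -/
theorem IsSample.average_moment [IsProbabilityMeasure μ] (h : IsSample μ p x z)
    (hβ : ∀ b, ‖β b‖ = 1) (hN : 0 < N) (hp1 : p 0 + p 1 = 1) (u w : Vec k) :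
    1 / (N : ℝ) * ∑ i, ∫ ω, response β (x i ω) (z i ω) ^ 2
        * (inner ℝ (x i ω) u * inner ℝ (x i ω) w) ∂μ
      = inner ℝ u w + 2 * (p 0 * (inner ℝ (β 0) u * inner ℝ (β 0) w)
        + p 1 * (inner ℝ (β 1) u * inner ℝ (β 1) w)) := by
  have hN' : (N : ℝ) ≠ 0 := by positivity
  simp_rw [(h.moment hβ _ u w).2]
  rw [Finset.sum_add_distrib, ← Finset.sum_mul, ← Finset.sum_mul, Finset.sum_sub_distrib,
    h.fraction]
  simp only [Finset.sum_const, Finset.card_univ, Fintype.card_fin, nsmul_eq_mul, mul_one]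
  rw [show p 1 = 1 - p 0 by linarith]
  field_simp
  ring

theorem IsSample.popMatrix_isMixtureForm [IsProbabilityMeasure μ] (h : IsSample μ p x z)
    (hβ : ∀ b, ‖β b‖ = 1) (hN : 0 < N) (hp1 : p 0 + p 1 = 1) : IsMixtureForm (popMatrix μ β x z) p β := by
  have hcoord : ∀ (y : Vec k) (a : Fin k), y a = inner ℝ y (EuclideanSpace.single a (1 : ℝ)) := by
    intro y a
    simp [EuclideanSpace.inner_single_right]
  have entry : ∀ a b, popMatrix μ β x z a b = p 0 * (β 0 a * β 0 b) + p 1 * (β 1 a * β 1 b) := by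
    intro a b
    have h_int := fun i => (h.moment hβ i (EuclideanSpace.single a (1 : ℝ))
      (EuclideanSpace.single b (1 : ℝ))).1
    have havg := h.average_moment hβ hN hp1 (EuclideanSpace.single a (1 : ℝ))
      (EuclideanSpace.single b (1 : ℝ))
    simp only [← hcoord] at h_int havg
    have hone : (inner ℝ (EuclideanSpace.single a (1 : ℝ)) (EuclideanSpace.single b (1 : ℝ)) : ℝ)
        = (1 : Matrix (Fin k) (Fin k) ℝ) a b := by
      simp [EuclideanSpace.inner_single_left, Matrix.one_apply]
    rw [popMatrix, Matrix.of_apply]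
    simp only [empMatrix_apply]
    rw [integral_const_mul, integral_sub ((integrable_finsetSum _ fun i _ => h_int i).const_mul _)
      (integrable_const _), integral_const_mul, integral_finsetSum _ fun i _ => h_int i, havg]
    simp only [integral_const, probReal_univ, smul_eq_mul, one_mul]
    rw [← hone, hcoord (EuclideanSpace.single a (1 : ℝ)) b]
    ring
  intro u
  ext a
  simp only [Matrix.ofLp_toLpLin, Matrix.toLin'_apply, Matrix.mulVec, dotProduct, entry, PiLp.add_apply,
    PiLp.smul_apply, smul_eq_mul, PiLp.inner_apply, RCLike.inner_apply, conj_trivial,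
    Finset.mul_sum, Finset.sum_mul]
  rw [← Finset.sum_add_distrib]
  refine Finset.sum_congr rfl fun b _ => ?_
  ring

end Population

/-! ### Pointwise bounds for truncated products -/

section Elementary

theorem exp_le_quadratic (s : ℝ) : Real.exp s ≤ 1 + s + s ^ 2 * Real.exp |s| := by
  have h := Complex.norm_exp_sub_sum_le_norm_mul_exp (s : ℂ) 2
  rw [Finset.sum_range_succ, Finset.sum_range_one] at h
  have e : Complex.exp s - ((s : ℂ) ^ 0 / (Nat.factorial 0 : ℂ) + (s : ℂ) ^ 1 / (Nat.factorial 1 : ℂ))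
      = ((Real.exp s - (1 + s) : ℝ) : ℂ) := by
    push_cast; simp
  rw [e, Complex.norm_real, Complex.norm_real, Real.norm_eq_abs, Real.norm_eq_abs, sq_abs] at h
  linarith [le_abs_self (Real.exp s - (1 + s))]

theorem pow_four_le_exp {y : ℝ} : y ^ 4 ≤ 32 * Real.exp (y ^ 2 / 4) := by
  have := Real.pow_div_factorial_le_exp (y ^ 2 / 4) (by positivity) 2
  norm_num [Nat.factorial] at this
  nlinarith

theorem pow_eight_le_exp {y : ℝ} : y ^ 8 ≤ 98304 * Real.exp (y ^ 2 / 8) := by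
  have := Real.pow_div_factorial_le_exp (y ^ 2 / 8) (by positivity) 4
  norm_num [Nat.factorial] at this
  nlinarith

theorem sq_mul_sq_le_exp (y g : ℝ) :
    y ^ 2 * g ^ 2 ≤ 16 * (Real.exp (y ^ 2 / 4) + Real.exp (g ^ 2 / 4)) := by
  nlinarith [pow_four_le_exp (y := y), pow_four_le_exp (y := g), sq_nonneg (y ^ 2 - g ^ 2)]

/-- Second order control of the exponential of a truncated product of squares. -/
theorem sq_mul_exp_truncated_le {r θ : ℝ} (y g : ℝ) (hr : 0 ≤ r) (hθ : |θ| * r ≤ 1 / 16) :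
    (min (y ^ 2) r * g ^ 2) ^ 2 * Real.exp |θ * (min (y ^ 2) r * g ^ 2)|
      ≤ 49152 * (Real.exp (y ^ 2 / 4) + Real.exp (g ^ 2 / 4)) := by
  set V := min (y ^ 2) r * g ^ 2 with hV
  have hV0 : 0 ≤ V := mul_nonneg (le_min (sq_nonneg _) hr) (sq_nonneg _)
  have h1 : V ≤ y ^ 2 * g ^ 2 := mul_le_mul_of_nonneg_right (min_le_left _ _) (sq_nonneg _)
  -- The purpose of the truncation: the exponent becomes quadratic in `g`, within reach of Gaussian
  -- integrability.
  have h2 : |θ * V| ≤ g ^ 2 / 16 := by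
    rw [abs_mul, abs_of_nonneg hV0]
    have h3 : V ≤ r * g ^ 2 := mul_le_mul_of_nonneg_right (min_le_right _ _) (sq_nonneg _)
    have h4 := mul_le_mul_of_nonneg_left h3 (abs_nonneg θ)
    have h5 := mul_le_mul_of_nonneg_right hθ (sq_nonneg g)
    linarith
  have h3 : V ^ 2 ≤ (y ^ 2 * g ^ 2) ^ 2 := pow_le_pow_left₀ hV0 h1 2
  set E := Real.exp (g ^ 2 / 16) with hE
  have hE2 : E ^ 2 = Real.exp (g ^ 2 / 8) := by
    rw [hE, ← Real.exp_nat_mul]; congr 1; push_cast; ring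
  have h4 : V ^ 2 * Real.exp |θ * V| ≤ (y ^ 2 * g ^ 2) ^ 2 * E :=
    mul_le_mul h3 (Real.exp_le_exp.mpr h2) (Real.exp_pos _).le (sq_nonneg _)
  have h5 : (y ^ 2 * g ^ 2) ^ 2 * E ≤ (y ^ 8 + g ^ 8 * E ^ 2) / 2 := by
    nlinarith [sq_nonneg (y ^ 4 - g ^ 4 * E)]
  have h6 : y ^ 8 ≤ 98304 * Real.exp (y ^ 2 / 4) := by
    refine pow_eight_le_exp.trans ?_
    gcongr
    linarith [sq_nonneg y]
  have h7 : g ^ 8 * E ^ 2 ≤ 98304 * Real.exp (g ^ 2 / 4) := by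
    have e : Real.exp (g ^ 2 / 4) = Real.exp (g ^ 2 / 8) * E ^ 2 := by
      rw [hE2, ← Real.exp_add]; congr 1; ring
    rw [e, ← mul_assoc]
    exact mul_le_mul_of_nonneg_right pow_eight_le_exp (sq_nonneg _)
  linarith

theorem exp_truncated_le {r θ : ℝ} (y g : ℝ) (hr : 0 ≤ r) (hθ : |θ| * r ≤ 1 / 16) :
    Real.exp (θ * (min (y ^ 2) r * g ^ 2)) ≤ Real.exp (g ^ 2 / 4) := by
  apply Real.exp_le_exp.mpr
  have hV0 : 0 ≤ min (y ^ 2) r * g ^ 2 := mul_nonneg (le_min (sq_nonneg _) hr) (sq_nonneg _)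
  have h3 : min (y ^ 2) r * g ^ 2 ≤ r * g ^ 2 :=
    mul_le_mul_of_nonneg_right (min_le_right _ _) (sq_nonneg _)
  have h4 := mul_le_mul_of_nonneg_left h3 (abs_nonneg θ)
  have h5 := mul_le_mul_of_nonneg_right hθ (sq_nonneg g)
  have h6 := mul_le_mul_of_nonneg_right (le_abs_self θ) hV0
  linarith [sq_nonneg g]

/-- The excess of `y²` over `r` is at most `8 exp((y² - r)/8)`, which releases the factor
`exp(-r/8)`; the remaining product is split by the arithmetic-geometric mean inequality. -/
theorem truncation_error_le {r : ℝ} (y g : ℝ) :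
    y ^ 2 * g ^ 2 - min (y ^ 2) r * g ^ 2
      ≤ 128 * Real.exp (-r / 8) * (Real.exp (y ^ 2 / 4) + Real.exp (g ^ 2 / 4)) := by
  have h1 : y ^ 2 - min (y ^ 2) r ≤ 8 * Real.exp ((y ^ 2 - r) / 8) := by
    rcases le_total (y ^ 2) r with h | h
    · rw [min_eq_left h, sub_self]; positivity
    · rw [min_eq_right h]
      linarith [Real.add_one_le_exp ((y ^ 2 - r) / 8)]
  have h2 : Real.exp ((y ^ 2 - r) / 8) = Real.exp (-r / 8) * Real.exp (y ^ 2 / 8) := by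
    rw [← Real.exp_add]; congr 1; ring
  have h3 : Real.exp (y ^ 2 / 8) ^ 2 = Real.exp (y ^ 2 / 4) := by
    rw [← Real.exp_nat_mul]; congr 1; push_cast; ring
  have h4 : Real.exp (y ^ 2 / 8) * g ^ 2
      ≤ 16 * (Real.exp (y ^ 2 / 4) + Real.exp (g ^ 2 / 4)) := by
    nlinarith [sq_nonneg (Real.exp (y ^ 2 / 8) - g ^ 2), pow_four_le_exp (y := g),
      Real.exp_pos (y ^ 2 / 4)]
  have h5 := mul_le_mul_of_nonneg_right h1 (sq_nonneg g)
  rw [h2] at h5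
  have h6 := mul_le_mul_of_nonneg_left h4 (Real.exp_pos (-r / 8)).le
  linarith

end Elementary

/-! ### Chernoff bound -/

section Chernoff

variable {Ω : Type*} [MeasurableSpace Ω] {μ : Measure Ω} [IsProbabilityMeasure μ] {N : ℕ}

/-- Chernoff bound for independent variables whose moment generating functions at `±θ` are
dominated to second order. -/
theorem measure_sum_sub_ge_le {V : Fin N → Ω → ℝ} (hind : iIndepFun V μ)
    (hm : ∀ i, Measurable (V i)) {e : Fin N → ℝ} {C θ t : ℝ} (hθ : 0 ≤ θ)
    (hi : ∀ s : ℝ, |s| = θ → ∀ i, Integrable (fun ω => Real.exp (s * V i ω)) μ)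
    (hmgf : ∀ s : ℝ, |s| = θ → ∀ i, mgf (V i) μ s ≤ Real.exp (s * e i + C * s ^ 2)) :
    μ.real {ω | N * t ≤ |∑ i, V i ω - ∑ i, e i|}
      ≤ 2 * Real.exp (N * C * θ ^ 2 - θ * (N * t)) := by
  have hprod : ∀ s : ℝ, |s| = θ → mgf (∑ i, V i) μ s ≤ Real.exp (s * ∑ i, e i + N * C * θ ^ 2) := by
    intro s hs
    rw [hind.mgf_sum hm]
    calc ∏ i, mgf (V i) μ s ≤ ∏ i, Real.exp (s * e i + C * s ^ 2) :=
          Finset.prod_le_prod (fun i _ => mgf_nonneg) fun i _ => hmgf s hs i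
      _ = Real.exp (s * ∑ i, e i + N * C * θ ^ 2) := by
          rw [← Real.exp_sum, Finset.sum_add_distrib, ← Finset.mul_sum, ← hs, sq_abs]
          simp only [Finset.sum_const, Finset.card_univ, Fintype.card_fin, nsmul_eq_mul]
          congr 1; ring
  have h_int : ∀ s : ℝ, |s| = θ → Integrable (fun ω => Real.exp (s * (∑ i, V i) ω)) μ :=
    fun s hs => hind.integrable_exp_mul_sum hm fun i _ => hi s hs i
  have s1 : |θ| = θ := abs_of_nonneg hθ
  have s2 : |-θ| = θ := by rw [abs_neg, s1]
  have up := measure_ge_le_exp_mul_mgf (∑ i, e i + N * t) hθ (h_int θ s1)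
  have lo := measure_le_le_exp_mul_mgf (∑ i, e i - N * t) (neg_nonpos.mpr hθ) (h_int (-θ) s2)
  have up' := up.trans (mul_le_mul_of_nonneg_left (hprod θ s1) (Real.exp_pos _).le)
  have lo' := lo.trans (mul_le_mul_of_nonneg_left (hprod (-θ) s2) (Real.exp_pos _).le)
  rw [← Real.exp_add] at up' lo'
  have hsub : {ω | N * t ≤ |∑ i, V i ω - ∑ i, e i|}
      ⊆ {ω | ∑ i, e i + N * t ≤ (∑ i, V i) ω} ∪ {ω | (∑ i, V i) ω ≤ ∑ i, e i - N * t} := by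
    intro ω hω
    simp only [Set.mem_union, Set.mem_ofPred_eq, Finset.sum_apply] at hω ⊢
    rcases le_abs.mp hω with h | h
    · left; linarith
    · right; linarith
  refine (measureReal_mono hsub).trans ((measureReal_union_le _ _).trans ?_)
  have e1 : -θ * (∑ i, e i + N * t) + (θ * ∑ i, e i + N * C * θ ^ 2)
      = N * C * θ ^ 2 - θ * (N * t) := by ring
  have e2 : -(-θ) * (∑ i, e i - N * t) + (-θ * ∑ i, e i + N * C * θ ^ 2)
      = N * C * θ ^ 2 - θ * (N * t) := by ring
  rw [e1] at up'
  rw [e2] at lo'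
  linarith

end Chernoff

/-! ### Truncated quadratic forms: moment generating function, bias, tails -/

section Concentration

variable {Ω : Type*} [MeasurableSpace Ω] {μ : Measure Ω}
  {k N : ℕ} {p : Fin 2 → ℝ} {β : Fin 2 → Vec k} {x : Fin N → Ω → Vec k} {z : Fin N → Ω → Bool}

/-- An integrable majorant for functions of one sample. -/
noncomputable def envelope (β : Fin 2 → Vec k) (u a : Vec k) : ℝ :=
  Real.exp ((inner ℝ a (β 0) : ℝ) ^ 2 / 4) + Real.exp ((inner ℝ a (β 1) : ℝ) ^ 2 / 4)
    + Real.exp ((inner ℝ a u : ℝ) ^ 2 / 4)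

theorem exp_add_exp_le_envelope (u a : Vec k) (b : Bool) :
    Real.exp (response β a b ^ 2 / 4) + Real.exp ((inner ℝ a u : ℝ) ^ 2 / 4)
      ≤ envelope β u a := by
  unfold envelope response
  have h0 := Real.exp_pos ((inner ℝ a (β 0) : ℝ) ^ 2 / 4)
  have h1 := Real.exp_pos ((inner ℝ a (β 1) : ℝ) ^ 2 / 4)
  cases b
  · simp; linarith
  · simp; linarith

theorem IsSample.envelope_integral (h : IsSample μ p x z) (hβ : ∀ b, ‖β b‖ = 1) {u : Vec k}
    (hu : ‖u‖ ≤ 1) (i : Fin N) :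
    Integrable (fun ω => envelope β u (x i ω)) μ ∧ ∫ ω, envelope β u (x i ω) ∂μ ≤ 6 := by
  obtain ⟨i0, v0⟩ := exp_inner_sq_div_four (hβ 0).le
  obtain ⟨i1, v1⟩ := exp_inner_sq_div_four (hβ 1).le
  obtain ⟨i2, v2⟩ := exp_inner_sq_div_four hu
  have i01 : Integrable (fun a : Vec k => Real.exp ((inner ℝ a (β 0) : ℝ) ^ 2 / 4)
    + Real.exp ((inner ℝ a (β 1) : ℝ) ^ 2 / 4)) (stdGaussian (Vec k)) := i0.add i1
  have hi : Integrable (envelope β u) (stdGaussian (Vec k)) := i01.add i2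
  refine ⟨h.integrable_comp i hi, ?_⟩
  rw [h.integral_comp i (by unfold envelope; fun_prop)]
  simp only [envelope]
  rw [integral_add i01 i2, integral_add i0 i1]
  linarith

/-- The truncated quadratic form of one sample in direction `u`. -/
noncomputable def truncated (β : Fin 2 → Vec k) (r : ℝ) (u : Vec k) (s : Vec k × Bool) : ℝ :=
  min (response β s.1 s.2 ^ 2) r * (inner ℝ s.1 u : ℝ) ^ 2

theorem measurable_response : Measurable fun s : Vec k × Bool => response β s.1 s.2 := by
  unfold response
  refine Measurable.ite (measurable_snd (measurableSet_singleton true)) ?_ ?_ <;> fun_prop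

theorem measurable_truncated (r : ℝ) (u : Vec k) : Measurable (truncated β r u) := by
  unfold truncated
  exact ((measurable_response.pow_const 2).min measurable_const).mul (by fun_prop)

theorem IsSample.measurable_pair (h : IsSample μ p x z) (i : Fin N) :
    Measurable fun ω => (x i ω, z i ω) := (h.measurable_x i).prodMk (h.measurable_z i)

theorem truncated_nonneg {r : ℝ} (hr : 0 ≤ r) (u : Vec k) (s : Vec k × Bool) :
    0 ≤ truncated β r u s := mul_nonneg (le_min (sq_nonneg _) hr) (sq_nonneg _)

theorem IsSample.integrable_truncated (h : IsSample μ p x z) (hβ : ∀ b, ‖β b‖ = 1) {u : Vec k}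
    (hu : ‖u‖ ≤ 1) {r : ℝ} (hr : 0 ≤ r) (i : Fin N) :
    Integrable (fun ω => truncated β r u (x i ω, z i ω)) μ := by
  refine ((h.envelope_integral hβ hu i).1.const_mul 16).mono'
    ((measurable_truncated r u).comp (h.measurable_pair i)).aestronglyMeasurable
    (ae_of_all _ fun ω => ?_)
  rw [Real.norm_of_nonneg (truncated_nonneg hr _ _)]
  have h1 : truncated β r u (x i ω, z i ω)
      ≤ response β (x i ω) (z i ω) ^ 2 * (inner ℝ (x i ω) u : ℝ) ^ 2 :=
    mul_le_mul_of_nonneg_right (min_le_left _ _) (sq_nonneg _)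
  have h2 := sq_mul_sq_le_exp (response β (x i ω) (z i ω)) (inner ℝ (x i ω) u)
  have h3 := exp_add_exp_le_envelope (β := β) u (x i ω) (z i ω)
  linarith

theorem IsSample.integrable_exp_truncated (h : IsSample μ p x z) (hβ : ∀ b, ‖β b‖ = 1) {u : Vec k}
    (hu : ‖u‖ ≤ 1) {r θ : ℝ} (hr : 0 ≤ r) (hθ : |θ| * r ≤ 1 / 16) (i : Fin N) :
    Integrable (fun ω => Real.exp (θ * truncated β r u (x i ω, z i ω))) μ := by
  refine (h.envelope_integral hβ hu i).1.mono'
    ((((measurable_truncated r u).comp (h.measurable_pair i)).const_mul θ).exp).aestronglyMeasurable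
    (ae_of_all _ fun ω => ?_)
  rw [Real.norm_of_nonneg (Real.exp_pos _).le]
  have h2 := exp_truncated_le (response β (x i ω) (z i ω)) (inner ℝ (x i ω) u) hr hθ
  have h3 := exp_add_exp_le_envelope (β := β) u (x i ω) (z i ω)
  have h4 := Real.exp_pos (response β (x i ω) (z i ω) ^ 2 / 4)
  refine le_trans h2 ?_
  linarith

theorem IsSample.mgf_truncated_le [IsProbabilityMeasure μ] (h : IsSample μ p x z)
    (hβ : ∀ b, ‖β b‖ = 1) {u : Vec k} (hu : ‖u‖ ≤ 1) {r θ : ℝ} (hr : 0 ≤ r)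
    (hθ : |θ| * r ≤ 1 / 16) (i : Fin N) :
    mgf (fun ω => truncated β r u (x i ω, z i ω)) μ θ
      ≤ Real.exp (θ * ∫ ω, truncated β r u (x i ω, z i ω) ∂μ + 294912 * θ ^ 2) := by
  obtain ⟨hi, hv⟩ := h.envelope_integral hβ hu i
  have hVi := h.integrable_truncated hβ hu hr i
  have h1 : mgf (fun ω => truncated β r u (x i ω, z i ω)) μ θ
      ≤ ∫ ω, (1 + θ * truncated β r u (x i ω, z i ω)
        + θ ^ 2 * 49152 * envelope β u (x i ω)) ∂μ := by
    refine integral_mono (h.integrable_exp_truncated hβ hu hr hθ i)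
      (((integrable_const 1).add (hVi.const_mul θ)).add (hi.const_mul _)) fun ω => ?_
    have h2 := exp_le_quadratic (θ * truncated β r u (x i ω, z i ω))
    have h3 := sq_mul_exp_truncated_le (response β (x i ω) (z i ω)) (inner ℝ (x i ω) u) hr hθ
    have h4 := exp_add_exp_le_envelope (β := β) u (x i ω) (z i ω)
    have h5 : truncated β r u (x i ω, z i ω) ^ 2
        * Real.exp |θ * truncated β r u (x i ω, z i ω)| ≤ 49152 * envelope β u (x i ω) :=
      h3.trans (by linarith)
    have h6 := mul_le_mul_of_nonneg_left h5 (sq_nonneg θ)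
    refine h2.trans ?_
    rw [mul_pow]
    linarith
  refine h1.trans ?_
  have i1 : Integrable (fun ω => 1 + θ * truncated β r u (x i ω, z i ω)) μ :=
    (integrable_const 1).add (hVi.const_mul θ)
  rw [integral_add i1 (hi.const_mul _), integral_add (integrable_const 1) (hVi.const_mul θ),
    integral_const_mul, integral_const_mul]
  simp only [integral_const, probReal_univ, smul_eq_mul, one_mul]
  -- The envelope has integral at most `6`, and `294912 = 6 * 49152`.
  have h7 := mul_le_mul_of_nonneg_left hv (by positivity : 0 ≤ θ ^ 2 * 49152)
  have h8 := Real.add_one_le_exp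
    (θ * ∫ ω, truncated β r u (x i ω, z i ω) ∂μ + 294912 * θ ^ 2)
  linarith

theorem IsSample.abs_integral_truncated_sub_le [IsProbabilityMeasure μ] (h : IsSample μ p x z)
    (hβ : ∀ b, ‖β b‖ = 1) {u : Vec k} (hu : ‖u‖ ≤ 1) {r : ℝ} (hr : 0 ≤ r) (i : Fin N) :
    |∫ ω, truncated β r u (x i ω, z i ω) ∂μ - ∫ ω, response β (x i ω) (z i ω) ^ 2
      * (inner ℝ (x i ω) u * inner ℝ (x i ω) u) ∂μ| ≤ 768 * Real.exp (-r / 8) := by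
  obtain ⟨hi, hv⟩ := h.envelope_integral hβ hu i
  have hVi := h.integrable_truncated hβ hu hr i
  have hm := (h.moment hβ i u u).1
  rw [abs_sub_comm, ← integral_sub hm hVi, abs_of_nonneg]
  · have h1 : ∫ ω, (response β (x i ω) (z i ω) ^ 2 * (inner ℝ (x i ω) u * inner ℝ (x i ω) u)
        - truncated β r u (x i ω, z i ω)) ∂μ
        ≤ ∫ ω, 128 * Real.exp (-r / 8) * envelope β u (x i ω) ∂μ := by
      refine integral_mono (hm.sub hVi) (hi.const_mul _) fun ω => ?_
      have h2 := truncation_error_le (r := r) (response β (x i ω) (z i ω)) (inner ℝ (x i ω) u)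
      have h3 := mul_le_mul_of_nonneg_left (exp_add_exp_le_envelope (β := β) u (x i ω) (z i ω))
        (by positivity : 0 ≤ 128 * Real.exp (-r / 8))
      simp only [truncated]
      rw [← sq]
      exact h2.trans h3
    refine h1.trans ?_
    rw [integral_const_mul]
    have := mul_le_mul_of_nonneg_left hv (by positivity : 0 ≤ 128 * Real.exp (-r / 8))
    linarith
  · refine integral_nonneg fun ω => ?_
    simp only [truncated, Pi.zero_apply]
    rw [← sq, ← sub_mul]
    exact mul_nonneg (sub_nonneg.mpr (min_le_left _ _)) (sq_nonneg _)

/-- Markov's inequality for the envelope; no direction is involved, so `u = 0` is used. -/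
theorem IsSample.measure_response_gt_le [IsProbabilityMeasure μ] (h : IsSample μ p x z)
    (hβ : ∀ b, ‖β b‖ = 1) (r : ℝ) (i : Fin N) :
    μ.real {ω | r < response β (x i ω) (z i ω) ^ 2} ≤ 6 * Real.exp (-r / 4) := by
  obtain ⟨hi, hv⟩ := h.envelope_integral hβ (u := 0) (by simp) i
  have hmk := mul_meas_ge_le_integral_of_nonneg (μ := μ) (ae_of_all _ fun ω => by
    simp only [envelope, Pi.zero_apply]; positivity) hi (Real.exp (r / 4))
  have hsub : {ω | r < response β (x i ω) (z i ω) ^ 2}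
      ⊆ {ω | Real.exp (r / 4) ≤ envelope β 0 (x i ω)} := by
    intro ω hω
    have h1 : Real.exp (r / 4) ≤ Real.exp (response β (x i ω) (z i ω) ^ 2 / 4) := by
      apply Real.exp_le_exp.mpr
      have : r < response β (x i ω) (z i ω) ^ 2 := hω
      linarith
    have h3 := exp_add_exp_le_envelope (β := β) 0 (x i ω) (z i ω)
    have h4 := Real.exp_pos ((inner ℝ (x i ω) (0 : Vec k) : ℝ) ^ 2 / 4)
    simp only [Set.mem_ofPred_eq]
    linarith
  have hle := measureReal_mono (μ := μ) hsub
  rw [neg_div, Real.exp_neg, ← div_eq_mul_inv, le_div_iff₀ (Real.exp_pos _), mul_comm]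
  exact (mul_le_mul_of_nonneg_left hle (Real.exp_pos _).le).trans (hmk.trans hv)

end Concentration

/-! ### Numerical consequences of the sample size -/

section SampleSize

theorem half_le_log_natCast {k : ℕ} (hk : 2 ≤ k) : 1 / 2 ≤ Real.log k := by
  have h1 : Real.log 2 ≤ Real.log k :=
    Real.log_le_log (by norm_num) (by exact_mod_cast hk)
  linarith [Real.log_two_gt_d9]

/-- Consequences of the lower bound on the sample size, with truncation level
`r = N t / (224 k)`. -/
theorem sampleSize_bounds {k : ℕ} (hk : 2 ≤ k) {n t : ℝ} (ht : 0 < t) (ht1 : t ≤ 1)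
    (hn : 40000000 * (k * Real.log k ^ 2) / t ^ 2 ≤ n) :
    28 * 294912 * k ≤ n * t ^ 2 ∧ 768 * Real.exp (-(n * t / (224 * k)) / 8) ≤ t ∧
      n * (6 * Real.exp (-(n * t / (224 * k)) / 4)) ≤ 1 / (2 * (k : ℝ) ^ 2) := by
  have hk' : (2 : ℝ) ≤ k := by exact_mod_cast hk
  have hl := half_le_log_natCast hk
  set L := Real.log k with hL
  have hL2 : 1 / 4 ≤ L ^ 2 := by nlinarith
  have hnt : 40000000 * (k * L ^ 2) ≤ n * t ^ 2 := by rwa [div_le_iff₀ (by positivity)] at hn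
  have hkL : (k : ℝ) * (1 / 4) ≤ k * L ^ 2 := by gcongr
  have h1 : 28 * 294912 * k ≤ n * t ^ 2 := by linarith
  have hn0 : 0 < n := by
    have : 0 < n * t ^ 2 := by linarith
    exact pos_of_mul_pos_left this (by positivity)
  -- A quarter of the truncation level, so that the two exponentials of the statement are
  -- `exp(-s/2)` and `exp(-s)`.
  set s := n * t / (896 * k) with hs
  have hs0 : 0 < s := by positivity
  have hr4 : n * t / (224 * k) / 4 = s := by rw [hs]; field_simp; ring
  have hr8 : n * t / (224 * k) / 8 = s / 2 := by rw [hs]; field_simp; ring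
  have hst : 40000 * L ^ 2 ≤ s * t := by
    rw [hs, div_mul_eq_mul_div, le_div_iff₀ (by positivity)]
    have : 0 ≤ k * L ^ 2 := by positivity
    linarith
  have hsum : 11 + 3 * L + 1 / t ≤ s / 2 := by
    have h2 : (11 + 3 * L) * t ≤ 11 + 3 * L := mul_le_of_le_one_right (by positivity) ht1
    have h3 : (11 + 3 * L + 1 / t) * t ≤ s / 2 * t := by
      rw [add_mul, one_div_mul_cancel ht.ne']
      nlinarith
    exact le_of_mul_le_mul_right h3 ht
  -- The three summands of `hsum` pay for the constant, for `k³ = exp(3 log k)` and for `1 / t`. The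
  -- constant is `2 * 12 * 896`, from `n = 896 k s / t`, `s ≤ 2 exp(s/2)` and the `12` in `hmain`.
  have hexp : 21504 * (k : ℝ) ^ 3 * (1 / t) ≤ Real.exp (s / 2) := by
    refine le_trans ?_ (Real.exp_le_exp.mpr hsum)
    rw [Real.exp_add, Real.exp_add]
    have e1 : (21504 : ℝ) ≤ Real.exp 11 := by
      have h5 : Real.exp 11 = Real.exp 1 ^ 11 := by rw [← Real.exp_nat_mul]; norm_num
      rw [h5]
      calc (21504 : ℝ) ≤ 2.7 ^ 11 := by norm_num
        _ ≤ Real.exp 1 ^ 11 := by gcongr; linarith [Real.exp_one_gt_d9]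
    have e2 : (k : ℝ) ^ 3 = Real.exp (3 * L) := by
      rw [hL, mul_comm, Real.exp_mul, Real.exp_log (by linarith)]
      norm_cast
    have e3 : 1 / t ≤ Real.exp (1 / t) := by linarith [Real.add_one_le_exp (1 / t)]
    rw [e2]
    gcongr
  have hmain : 12 * n * (k : ℝ) ^ 2 ≤ Real.exp s := by
    have e1 : n = 896 * k * s * (1 / t) := by rw [hs]; field_simp
    have e2 : s ≤ 2 * Real.exp (s / 2) := by linarith [Real.add_one_le_exp (s / 2)]
    have e3 : Real.exp s = Real.exp (s / 2) * Real.exp (s / 2) := by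
      rw [← Real.exp_add]; congr 1; ring
    rw [e3]
    calc 12 * n * (k : ℝ) ^ 2 = 10752 * (k : ℝ) ^ 3 * (1 / t) * s := by rw [e1]; ring
      _ ≤ 10752 * (k : ℝ) ^ 3 * (1 / t) * (2 * Real.exp (s / 2)) := by gcongr
      _ = 21504 * (k : ℝ) ^ 3 * (1 / t) * Real.exp (s / 2) := by ring
      _ ≤ Real.exp (s / 2) * Real.exp (s / 2) := by gcongr
  refine ⟨h1, ?_, ?_⟩
  · rw [neg_div, hr8, Real.exp_neg, ← div_eq_mul_inv, div_le_iff₀ (Real.exp_pos _)]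
    refine le_of_sq_le_sq ?_ (by positivity)
    have e3 : Real.exp (s / 2) ^ 2 = Real.exp s := by
      rw [← Real.exp_nat_mul]; congr 1; push_cast; ring
    rw [mul_pow, e3]
    have e4 : n ≤ 12 * n * (k : ℝ) ^ 2 := by
      have e6 : 1 ≤ (k : ℝ) ^ 2 := one_le_pow₀ (by linarith)
      linarith [mul_le_mul_of_nonneg_left e6 hn0.le]
    have e5 := mul_le_mul_of_nonneg_left (e4.trans hmain) (sq_nonneg t)
    nlinarith
  · rw [neg_div, hr4, Real.exp_neg, le_div_iff₀ (by positivity)]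
    have e1 : n * (6 * (Real.exp s)⁻¹) * (2 * (k : ℝ) ^ 2)
        = 12 * n * (k : ℝ) ^ 2 / Real.exp s := by
      rw [div_eq_mul_inv]; ring
    rw [e1]
    exact div_le_one_of_le₀ hmain (Real.exp_pos _).le

/-- At most `2 * 25 ^ k` test vectors fail with probability `2 exp(-7k)` each; the rate `7` is
enough because `8 k² 25^k ≤ 800^k` and `800 ≤ e⁷`. -/
theorem union_bound_le {k : ℕ} (hk : 2 ≤ k) :
    2 * 25 ^ k * (2 * Real.exp (-(7 * (k : ℝ)))) ≤ 1 / (2 * (k : ℝ) ^ 2) := by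
  have hk' : (2 : ℝ) ≤ k := by exact_mod_cast hk
  have h1 : (k : ℝ) ^ 2 ≤ 4 ^ k := by
    have h2 : (k : ℝ) ≤ 2 ^ k := by exact_mod_cast (Nat.lt_two_pow_self).le
    calc (k : ℝ) ^ 2 ≤ (2 ^ k) ^ 2 := by gcongr
      _ = 4 ^ k := by rw [← pow_mul, mul_comm, pow_mul]; norm_num
  have h8 : (8 : ℝ) ≤ 8 ^ k := by
    calc (8 : ℝ) = 8 ^ 1 := by norm_num
      _ ≤ 8 ^ k := pow_le_pow_right₀ (by norm_num) (by omega)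
  have he : (800 : ℝ) ^ k ≤ Real.exp (7 * k) := by
    have h5 : Real.exp (7 * k) = (Real.exp 1 ^ 7) ^ k := by
      rw [← Real.exp_nat_mul, ← Real.exp_nat_mul]; congr 1; push_cast; ring
    rw [h5]
    gcongr
    calc (800 : ℝ) ≤ 2.7 ^ 7 := by norm_num
      _ ≤ Real.exp 1 ^ 7 := by gcongr; linarith [Real.exp_one_gt_d9]
  rw [Real.exp_neg, le_div_iff₀ (by positivity)]
  have e1 : 2 * 25 ^ k * (2 * (Real.exp (7 * (k : ℝ)))⁻¹) * (2 * (k : ℝ) ^ 2)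
      = 8 * (k : ℝ) ^ 2 * 25 ^ k / Real.exp (7 * k) := by
    rw [div_eq_mul_inv]; ring
  rw [e1]
  refine div_le_one_of_le₀ (le_trans ?_ he) (Real.exp_pos _).le
  calc 8 * (k : ℝ) ^ 2 * 25 ^ k ≤ 8 ^ k * 4 ^ k * 25 ^ k := by gcongr
    _ = 800 ^ k := by rw [← mul_pow, ← mul_pow]; norm_num

end SampleSize

/-! ### Concentration of the empirical matrix in operator norm -/

section OperatorConcentration

variable {Ω : Type*} [MeasurableSpace Ω] {μ : Measure Ω} [IsProbabilityMeasure μ]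
  {k N : ℕ} {p : Fin 2 → ℝ} {β : Fin 2 → Vec k} {x : Fin N → Ω → Vec k} {z : Fin N → Ω → Bool}

/-- A sample without large responses whose truncated quadratic form in direction `u` is close to
its mean has an empirical quadratic form close to that of the population. -/
theorem IsSample.abs_inner_empMatrix_sub_le (h : IsSample μ p x z) (hβ : ∀ b, ‖β b‖ = 1)
    (hN : 0 < N) (hp1 : p 0 + p 1 = 1) {u : Vec k} (hu : ‖u‖ ≤ 1) {r t : ℝ} (hr : 0 ≤ r)
    (hrt : 768 * Real.exp (-r / 8) ≤ t) {ω : Ω}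
    (hω : ∀ i, response β (x i ω) (z i ω) ^ 2 ≤ r)
    (hdev : |∑ i, truncated β r u (x i ω, z i ω)
      - ∑ i, ∫ ω, truncated β r u (x i ω, z i ω) ∂μ| < N * t) :
    |inner ℝ u ((Matrix.toEuclideanLin (empMatrix β x z ω)
      - Matrix.toEuclideanLin (popMatrix μ β x z)) u)| ≤ t := by
  have hN' : (0 : ℝ) < N := by exact_mod_cast hN
  have hpop := h.popMatrix_isMixtureForm hβ hN hp1 u
  have havg := h.average_moment hβ hN hp1 u u
  set m : Fin N → ℝ := fun i => ∫ ω, response β (x i ω) (z i ω) ^ 2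
    * (inner ℝ (x i ω) u * inner ℝ (x i ω) u) ∂μ
  set e : Fin N → ℝ := fun i => ∫ ω, truncated β r u (x i ω, z i ω) ∂μ
  have htr : ∀ i, truncated β r u (x i ω, z i ω) = response β (x i ω) (z i ω) ^ 2
      * (inner ℝ (x i ω) u * inner ℝ (x i ω) u) := by
    intro i
    simp only [truncated]
    rw [min_eq_left (hω i), sq (inner ℝ (x i ω) u : ℝ)]
  have hbias : |∑ i, e i - ∑ i, m i| ≤ N * t := by
    rw [← Finset.sum_sub_distrib]
    refine (Finset.abs_sum_le_sum_abs _ _).trans ?_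
    refine (Finset.sum_le_sum fun i _ =>
      (h.abs_integral_truncated_sub_le hβ hu hr i).trans hrt).trans ?_
    simp
  -- Fluctuation and bias each contribute at most `N t`; the factor `1/2` in `(M - I)/2` brings
  -- their sum down to `t`.
  have hquad : inner ℝ u ((Matrix.toEuclideanLin (empMatrix β x z ω)
      - Matrix.toEuclideanLin (popMatrix μ β x z)) u)
      = 1 / (2 * (N : ℝ)) * ((∑ i, truncated β r u (x i ω, z i ω) - ∑ i, e i)
        + (∑ i, e i - ∑ i, m i)) := by
    rw [LinearMap.sub_apply, inner_sub_right, inner_empMatrix, hpop, inner_add_right,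
      real_inner_smul_right, real_inner_smul_right, real_inner_comm (β 0) u,
      real_inner_comm (β 1) u]
    simp_rw [htr]
    have e1 : 1 / (2 * (N : ℝ)) = 1 / 2 * (1 / (N : ℝ)) := by field_simp
    rw [e1]
    linear_combination 1 / 2 * havg
  rw [hquad, abs_mul, abs_of_pos (by positivity), div_mul_eq_mul_div, one_mul,
    div_le_iff₀ (by positivity)]
  refine (abs_add_le _ _).trans ?_
  linarith

/-- With probability at least `1 - 1/k²` the empirical matrix is within `8 t` of the population
matrix. -/
theorem IsSample.measure_empMatrix_sub_gt_le (h : IsSample μ p x z) (hβ : ∀ b, ‖β b‖ = 1)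
    (hN : 0 < N) (hp1 : p 0 + p 1 = 1) (hk : 2 ≤ k) {t : ℝ} (ht : 0 < t) (ht1 : t ≤ 1)
    (hn : 40000000 * (k * Real.log k ^ 2) / t ^ 2 ≤ (N : ℝ)) :
    μ {ω | ¬ ∀ u, ‖Matrix.toEuclideanLin (empMatrix β x z ω) u
        - Matrix.toEuclideanLin (popMatrix μ β x z) u‖ ≤ 8 * t * ‖u‖}
      ≤ ENNReal.ofReal (1 / (k : ℝ) ^ 2) := by
  have hN' : (0 : ℝ) < N := by exact_mod_cast hN
  have hk' : (2 : ℝ) ≤ k := by exact_mod_cast hk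
  obtain ⟨T, hTcard, hT1, hT⟩ := exists_testing_set (Vec k)
  obtain ⟨n1, n2, n3⟩ := sampleSize_bounds hk ht ht1 hn
  have n4 := union_bound_le hk
  set r : ℝ := N * t / (224 * k) with hr
  have hr0 : 0 ≤ r := by positivity
  -- Chosen so that `θ r = 1/16` exactly and `θ (N t) = 14 k`. The quadratic term costs at most `7
  -- k`, which leaves the exponent `-7 k`.
  set θ : ℝ := 14 * k / (N * t) with hθ
  have hθ0 : 0 ≤ θ := by positivity
  have hθr : ∀ s : ℝ, |s| = θ → |s| * r ≤ 1 / 16 := by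
    intro s hs
    rw [hs, hθ, hr]
    apply le_of_eq
    field_simp
    norm_num
  set big : Fin N → Set Ω := fun i => {ω | r < response β (x i ω) (z i ω) ^ 2}
  set dev : Vec k → Set Ω := fun u => {ω | N * t ≤ |∑ i, truncated β r u (x i ω, z i ω)
    - ∑ i, ∫ ω, truncated β r u (x i ω, z i ω) ∂μ|}
  have hsub : {ω | ¬ ∀ u, ‖Matrix.toEuclideanLin (empMatrix β x z ω) u
        - Matrix.toEuclideanLin (popMatrix μ β x z) u‖ ≤ 8 * t * ‖u‖}
      ⊆ (⋃ i, big i) ∪ ⋃ u ∈ T, dev u := by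
    intro ω hω
    by_contra hcon
    simp only [Set.mem_union, Set.mem_iUnion, not_or, not_exists] at hcon
    apply hω
    refine hT (Matrix.toEuclideanLin (empMatrix β x z ω)
      - Matrix.toEuclideanLin (popMatrix μ β x z)) ?_ t fun u hu => ?_
    · exact (Matrix.isSymmetric_toEuclideanLin_iff.mpr (empMatrix_isHermitian ω)).sub
        (h.popMatrix_isMixtureForm hβ hN hp1).isSymmetric
    · exact h.abs_inner_empMatrix_sub_le hβ hN hp1 (hT1 u hu) hr0 n2
        (fun i => not_lt.mp (hcon.1 i)) (not_le.mp (hcon.2 u hu))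
  have hbig : μ.real (⋃ i, big i) ≤ 1 / (2 * (k : ℝ) ^ 2) := by
    refine (measureReal_iUnion_fintype_le _).trans ?_
    refine (Finset.sum_le_sum fun i _ => h.measure_response_gt_le hβ r i).trans ?_
    simpa using n3
  have hdev1 : ∀ u ∈ T, μ.real (dev u) ≤ 2 * Real.exp (-(7 * (k : ℝ))) := by
    intro u hu
    have hind : iIndepFun (fun i ω => truncated β r u (x i ω, z i ω)) μ :=
      h.indep_samples.comp (fun _ => truncated β r u) fun _ => measurable_truncated r u
    refine (measure_sum_sub_ge_le hind
      (fun i => (measurable_truncated r u).comp (h.measurable_pair i)) (C := 294912) hθ0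
      (fun s hs i => h.integrable_exp_truncated hβ (hT1 u hu) hr0 (hθr s hs) i)
      (fun s hs i => h.mgf_truncated_le hβ (hT1 u hu) hr0 (hθr s hs) i)).trans ?_
    gcongr
    have e1 : θ * (N * t) = 14 * k := by rw [hθ]; field_simp
    have e2 : N * 294912 * θ ^ 2 ≤ 7 * k := by
      have e3 : N * 294912 * θ ^ 2 = 294912 * (14 * k) ^ 2 / (N * t ^ 2) := by
        rw [hθ]; field_simp
      rw [e3, div_le_iff₀ (by positivity)]
      nlinarith
    rw [e1]
    linarith
  have hdev : μ.real (⋃ u ∈ T, dev u) ≤ 1 / (2 * (k : ℝ) ^ 2) := by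
    refine (measureReal_biUnion_finset_le _ _).trans ?_
    refine (Finset.sum_le_sum hdev1).trans ?_
    rw [Finset.sum_const, nsmul_eq_mul]
    refine le_trans ?_ n4
    gcongr
    rw [finrank_euclideanSpace, Fintype.card_fin] at hTcard
    exact_mod_cast hTcard
  have hfin : μ.real {ω | ¬ ∀ u, ‖Matrix.toEuclideanLin (empMatrix β x z ω) u
        - Matrix.toEuclideanLin (popMatrix μ β x z) u‖ ≤ 8 * t * ‖u‖} ≤ 1 / (k : ℝ) ^ 2 := by
    refine (measureReal_mono hsub).trans ((measureReal_union_le _ _).trans ?_)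
    have : 1 / (k : ℝ) ^ 2 = 1 / (2 * (k : ℝ) ^ 2) + 1 / (2 * (k : ℝ) ^ 2) := by
      field_simp; norm_num
    linarith
  rw [← ofReal_measureReal]
  exact ENNReal.ofReal_le_ofReal hfin

end OperatorConcentration

/-! ### Size of `deltaTilde` -/

section DeltaTilde

variable {k : ℕ} {p : Fin 2 → ℝ} {β : Fin 2 → Vec k} {c : ℝ}

theorem deltaTilde_le_one (hc : 0 < c) (hc2 : c < 1 / 2) (hp : ∀ b, 0 < p b)
    (hp1 : p 0 + p 1 = 1) (hβ : ∀ b, ‖β b‖ = 1) (hδ : 0 < deltaTilde c p β) :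
    deltaTilde c p β ≤ 1 := by
  obtain ⟨hκ, hκ1, -, hδe⟩ := kappa_pos_and_deltaTilde_eq hp hδ
  have hm : 0 < min (p 0) (p 1) := lt_min (hp 0) (hp 1)
  have hm2 : min (p 0) (p 1) ≤ 1 := by
    have := min_le_left (p 0) (p 1)
    linarith [hp 1]
  have hD2 : ‖β 0 - β 1‖ ≤ 2 := by
    refine (norm_sub_le _ _).trans ?_
    rw [hβ, hβ]; norm_num
  rw [hδe]
  have h1 : 0 ≤ 1 - kappa p β := by linarith
  calc c ^ 2 * min (p 0) (p 1) ^ 3 * ‖β 0 - β 1‖ ^ 2 * (1 - kappa p β) * kappa p β ^ 2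
      ≤ (1 / 2) ^ 2 * 1 ^ 3 * 2 ^ 2 * 1 * 1 ^ 2 := by
        gcongr
        linarith
    _ = 1 := by norm_num

end DeltaTilde

end MixedRegression

/-! ### Main theorem -/

theorem mainTheorem4 (c : ℝ) (hc_pos : 0 < c) (hc_lt : c < 1 / 2) :
    ∃ c₁ : ℝ, 0 < c₁ ∧
      ∀ (k N : ℕ) (β : Fin 2 → MixedRegression.Vec k) (p : Fin 2 → ℝ)
        (Ω : Type*) [MeasurableSpace Ω] (μ : Measure Ω) [IsProbabilityMeasure μ]
        (x : Fin N → Ω → MixedRegression.Vec k) (z : Fin N → Ω → Bool),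
        (∀ b, ‖β b‖ = 1) →
        (∀ b, 0 < p b) → p 0 + p 1 = 1 →
        MixedRegression.IsSample μ p x z →
        0 < MixedRegression.deltaTilde c p β →
        c₁ * (1 / MixedRegression.deltaTilde c p β) ^ 2 * k * Real.log k ^ 2 ≤ (N : ℝ) →
        (∃ vs ls, MixedRegression.IsReference (MixedRegression.popMatrix μ β x z) p β vs ls) ∧
        ∀ vs ls, MixedRegression.IsReference (MixedRegression.popMatrix μ β x z) p β vs ls →
          μ {ω | ¬ ((∃ v l,
                MixedRegression.IsTopTwoEigenpairs (MixedRegression.empMatrix β x z ω) v l ∧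
                MixedRegression.IsAligned v l vs ls) ∧
              ∀ v l,
                MixedRegression.IsTopTwoEigenpairs (MixedRegression.empMatrix β x z ω) v l →
                MixedRegression.IsAligned v l vs ls →
                MixedRegression.err (MixedRegression.closedForm p v l) β
                  ≤ c * min (p 0) (p 1) * ‖β 0 - β 1‖)}
            ≤ ENNReal.ofReal (1 / (k : ℝ) ^ 2) := by
  -- Concentration is used at `t = δ / 384`, since the operator error `8 t` has to be `δ / 48`. The
  -- constant is independent of `c`, which enters through `δ` alone.
  refine ⟨40000000 * 384 ^ 2, by norm_num, ?_⟩
  intro k N β p Ω _ μ _ x z hβ hp hp1 h hδ hn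
  have hi := MixedRegression.linearIndependent_of_deltaTilde_pos hp hp1 hβ hδ
  have hk := MixedRegression.two_le_of_linearIndependent hi
  have hδ1 := MixedRegression.deltaTilde_le_one hc_pos hc_lt hp hp1 hβ hδ
  obtain ⟨hκ, -, -, -⟩ := MixedRegression.kappa_pos_and_deltaTilde_eq hp hδ
  set δ := MixedRegression.deltaTilde c p β with hδdef
  have hn' : 40000000 * (k * Real.log k ^ 2) / (δ / 384) ^ 2 ≤ (N : ℝ) := by
    refine le_trans (le_of_eq ?_) hn
    field_simp
  have hN : 0 < N := by
    have hl := MixedRegression.half_le_log_natCast hk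
    have hk' : (2 : ℝ) ≤ k := by exact_mod_cast hk
    have : (0 : ℝ) < N := lt_of_lt_of_le (by positivity) hn'
    exact_mod_cast this
  have hA := h.popMatrix_isMixtureForm hβ hN hp1
  refine ⟨hA.exists_isReference hp hp1 hβ hi hκ, fun vs ls href => ?_⟩
  -- The failure event lies in the event of a large operator error, for every reference at once;
  -- monotonicity of `μ` requires no measurability of either set.
  refine le_trans (measure_mono fun ω hω => ?_)
    (h.measure_empMatrix_sub_gt_le hβ hN hp1 hk (t := δ / 384) (by positivity) (by linarith) hn')
  intro hE
  have hB := MixedRegression.empMatrix_isHermitian (β := β) (x := x) (z := z) ω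
  refine hω ⟨MixedRegression.exists_isAligned hk hB, fun v l hv hal => ?_⟩
  refine MixedRegression.err_closedForm_le hc_pos hc_lt hp hp1 hβ hδ hA hB (fun u => ?_) href hv hal
  refine (hE u).trans (le_of_eq ?_)
  rw [← hδdef]
  ring
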